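/- Let $D>0$ be a non-square integer with $D\equiv 0$ or $1 \pmod 4$, and let $\mathcal{O}_D=\mathbb{Z}[\gamma]$, $\gamma=\frac{D+\sqrt D}{2}$, be the real quadratic order of discriminant $D$. A $(1,6)$-polarized abelian surface with a choice of real multiplication by $\mathcal{O}_D$ is a complex abelian surface $T=\mathbb{C}^2/\Lambda$ with a polarization of type $(1,6)$, together with an injective ring homomorphism $\rho:\mathcal{O}_D\hookrightarrow \mathrm{End}(T)$ whose image consists of endomorphisms that are self-adjoint with respect to the polarization, and which is proper, i.e. does not extend to an action of a strictly larger quadratic order $\mathcal{O}_E\supsetneq\mathcal{O}_D$ on $T$. Two such triples are isomorphic if there is an isomorphism of the polarized abelian surfaces that intertwines the two actions of $\mathcal{O}_D$. Let $\mathcal{M}_D$ be the moduli space of isomorphism classes, with its structure of a complex analytic space coming from period matrices in the Siegel upper half space $\mathbb{H}_2$: its analytic subsets are those whose preimage, in the disjoint union over all integral $4\times4$ matrices $R$ of the loci of period matrices in $\mathbb{H}_2$ of surfaces marked by a symplectic basis in which $\gamma$ acts by $R$, is analytic. Then: 1. $\mathcal{M}_D$ is empty if $D\equiv 5\pmod 8$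 or $D\equiv 2\pmod 3$; 2. $\mathcal{M}_D$ is non-empty and irreducible if $D\equiv 0$ or $12\pmod{24}$; 3. $\mathcal{M}_D$ has exactly two irreducible components if $D\equiv 4$, $9$ or $16\pmod{24}$; 4. $\mathcal{M}_D$ has exactly four irreducible components if $D\equiv 1\pmod{24}$. -/

import Mathlib

noncomputable section

namespace RealMult

/-- The quadratic order `𝒪_D = ℤ[γ]` of discriminant `D ≡ 0, 1 mod 4`, where
`γ = (D + √D) / 2`, that is `γ² = (D - D²) / 4 + D γ`. The division is exact for such `D`. -/
abbrev QuadOrder (D : ℤ) : Type := QuadraticAlgebra ℤ ((D - D ^ 2) / 4) D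

/-- The generator `γ = (D + √D) / 2` of `𝒪_D` as a `ℤ`-algebra. -/
def gammaD (D : ℤ) : QuadOrder D := QuadraticAlgebra.omega

/-- `ℂ²`, the universal cover of a complex torus of dimension two. -/
abbrev C2 : Type := Fin 2 → ℂ

/-- The entries of the polarization type `(1, n)`. -/
def polType (n : ℕ) : Fin 2 → ℕ := ![1, n]

/-- A `ℤ`-basis `λ₁, λ₂, μ₁, μ₂` of `Λ`, where `λᵢ = b (inl i)` and `μᵢ = b (inr i)`, that is
symplectic of type `(1, n)` for the alternating form `E`: its Gram matrix is
`((0, P), (-P, 0))` with `P = diag (1, n)`. -/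
def IsSymplecticBasis (n : ℕ) {Λ : Submodule ℤ C2} (E : LinearMap.BilinForm ℝ C2)
    (b : Module.Basis (Fin 2 ⊕ Fin 2) ℤ Λ) : Prop :=
  ∀ i j : Fin 2,
    E (b (Sum.inl i)) (b (Sum.inl j)) = 0 ∧
    E (b (Sum.inr i)) (b (Sum.inr j)) = 0 ∧
    E (b (Sum.inl i)) (b (Sum.inr j)) = (if i = j then (polType n i : ℝ) else 0) ∧
    E (b (Sum.inr i)) (b (Sum.inl j)) = -(if i = j then (polType n i : ℝ) else 0)

/-- A `(1, n)`-polarized complex abelian surface `T = ℂ² / Λ`. The polarization is given by its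
Riemann form `E = Im H`, where `H (v, w) = E (iv, w) + i E (v, w)` is the positive definite
Hermitian form of the polarization. -/
structure PolarizedAbelianSurface (n : ℕ) where
  /-- the period lattice -/
  lattice : Submodule ℤ C2
  discrete : DiscreteTopology lattice
  span_eq_top : Submodule.span ℝ (lattice : Set C2) = ⊤
  /-- the Riemann form of the polarization -/
  form : LinearMap.BilinForm ℝ C2
  alternating : ∀ v : C2, form v v = 0
  integral : ∀ v ∈ lattice, ∀ w ∈ lattice, ∃ m : ℤ, form v w = m
  form_I_I : ∀ v w : C2, form (Complex.I • v) (Complex.I • w) = form v w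
  form_pos : ∀ v : C2, v ≠ 0 → 0 < form (Complex.I • v) v
  hasType : ∃ b : Module.Basis (Fin 2 ⊕ Fin 2) ℤ lattice, IsSymplecticBasis n form b

/-- The endomorphism ring of `T = ℂ² / Λ`: the `ℂ`-linear maps that map `Λ` into itself. -/
def PolarizedAbelianSurface.endRing {n : ℕ} (T : PolarizedAbelianSurface n) :
    Subring (Module.End ℂ C2) where
  carrier := {f | ∀ v ∈ T.lattice, f v ∈ T.lattice}
  mul_mem' := fun hf hg v hv => hf _ (hg v hv)
  one_mem' := fun _ hv => hv
  add_mem' := fun hf hg v hv => T.lattice.add_mem (hf v hv) (hg v hv)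
  zero_mem' := fun _ _ => T.lattice.zero_mem
  neg_mem' := fun hf v hv => T.lattice.neg_mem (hf v hv)

/-- An action `ρ` of `𝒪_D` on `T` is proper if it does not extend to an action of a strictly
larger quadratic order `𝒪_E`. -/
def IsProperAction {n : ℕ} (T : PolarizedAbelianSurface n) {D : ℤ}
    (ρ : QuadOrder D →+* T.endRing) : Prop :=
  ∀ E : ℤ, (E ≡ 0 [ZMOD 4] ∨ E ≡ 1 [ZMOD 4]) →
    ∀ ι : QuadOrder D →+* QuadOrder E,
      (∃ ρ' : QuadOrder E →+* T.endRing, ρ'.comp ι = ρ) → Function.Surjective ι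

/-- A `(1, n)`-polarized abelian surface with a choice of (proper) real multiplication
by `𝒪_D`: an embedding `ρ` of `𝒪_D` into the endomorphism ring, by endomorphisms that are
self-adjoint for the polarization. -/
structure RMSurface (n : ℕ) (D : ℤ) extends PolarizedAbelianSurface n where
  ρ : QuadOrder D →+* toPolarizedAbelianSurface.endRing
  injective : Function.Injective ρ
  selfAdjoint : ∀ (a : QuadOrder D) (v w : C2),
    form ((ρ a : Module.End ℂ C2) v) w = form v ((ρ a : Module.End ℂ C2) w)
  proper : IsProperAction toPolarizedAbelianSurface ρ

/-- Isomorphisms of polarized abelian surfaces that intertwine the chosen real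
multiplications. -/
def RMSurface.Iso {n : ℕ} {D : ℤ} (X Y : RMSurface n D) : Prop :=
  ∃ φ : C2 ≃ₗ[ℂ] C2,
    (∀ v : C2, φ v ∈ Y.lattice ↔ v ∈ X.lattice) ∧
    (∀ v w : C2, Y.form (φ v) (φ w) = X.form v w) ∧
    (∀ (a : QuadOrder D) (v : C2),
      φ ((X.ρ a : Module.End ℂ C2) v) = (Y.ρ a : Module.End ℂ C2) (φ v))

theorem RMSurface.iso_equivalence (n : ℕ) (D : ℤ) :
    Equivalence (RMSurface.Iso (n := n) (D := D)) where
  refl X := ⟨LinearEquiv.refl ℂ C2, fun _ => Iff.rfl, fun _ _ => rfl, fun _ _ => rfl⟩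
  symm := by
    rintro X Y ⟨φ, h1, h2, h3⟩
    refine ⟨φ.symm, fun v => ?_, fun v w => ?_, fun a v => ?_⟩
    · rw [← h1, φ.apply_symm_apply]
    · rw [← h2, φ.apply_symm_apply, φ.apply_symm_apply]
    · rw [LinearEquiv.symm_apply_eq, h3, φ.apply_symm_apply]
  trans := by
    rintro X Y Z ⟨φ, h1, h2, h3⟩ ⟨ψ, k1, k2, k3⟩
    refine ⟨φ.trans ψ, fun v => ?_, fun v w => ?_, fun a v => ?_⟩
    · rw [LinearEquiv.trans_apply, k1, h1]
    · rw [LinearEquiv.trans_apply, LinearEquiv.trans_apply, k2, h2]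
    · rw [LinearEquiv.trans_apply, LinearEquiv.trans_apply, h3, k3]

/-- Isomorphism as a setoid. -/
def RMSurface.isoSetoid (n : ℕ) (D : ℤ) : Setoid (RMSurface n D) :=
  ⟨RMSurface.Iso, RMSurface.iso_equivalence n D⟩

/-- The moduli space of `(1, n)`-polarized abelian surfaces with a choice of real
multiplication by `𝒪_D`; its points are the isomorphism classes. -/
def ModuliSpace (n : ℕ) (D : ℤ) : Type := Quotient (RMSurface.isoSetoid n D)

/-- The point of the moduli space given by a surface with real multiplication. -/
def ModuliSpace.mk {n : ℕ} {D : ℤ} (X : RMSurface n D) : ModuliSpace n D :=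
  Quotient.mk (RMSurface.isoSetoid n D) X

/-! ### The analytic structure of the moduli space -/

/-- The symmetric `2 × 2` matrix with entries `z₁, z₂, z₃`. -/
def symMatrix (z : Fin 3 → ℂ) : Matrix (Fin 2) (Fin 2) ℂ :=
  !![z 0, z 1; z 1, z 2]

/-- Siegel's upper half space `ℍ₂` of symmetric complex `2 × 2` matrices with positive definite
imaginary part, as an open subset of `ℂ³`. -/
def siegelSpace : Set (Fin 3 → ℂ) :=
  {z | ((symMatrix z).map Complex.im).PosDef}

/-- `A` is a (closed) analytic subset of the open set `U`: near each point of `U` it is the set of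
common zeros of finitely many holomorphic functions. -/
def IsAnalyticSubset {V : Type*} [NormedAddCommGroup V] [NormedSpace ℂ V] (U A : Set V) : Prop :=
  A ⊆ U ∧ ∀ p ∈ U, ∃ W : Set V, IsOpen W ∧ p ∈ W ∧ W ⊆ U ∧
    ∃ (k : ℕ) (f : Fin k → V → ℂ), (∀ j, AnalyticOnNhd ℂ (f j) W) ∧
      A ∩ W = {w ∈ W | ∀ j, f j w = 0}

/-- `X` has a symplectic basis `λ₁, λ₂, μ₁, μ₂` of its lattice such that, in suitable linear
coordinates `φ` of `ℂ²`, the period matrix is `(Z | P)`, where `Z` is the symmetric matrix given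
by `z` and `P = diag (1, n)`, and such that `R` is the matrix of `γ` in this basis (the rational
representation of the real multiplication). -/
def IsPeriod {n : ℕ} {D : ℤ} (X : RMSurface n D) (z : Fin 3 → ℂ)
    (R : Matrix (Fin 2 ⊕ Fin 2) (Fin 2 ⊕ Fin 2) ℤ) : Prop :=
  ∃ (b : Module.Basis (Fin 2 ⊕ Fin 2) ℤ X.lattice) (φ : C2 ≃ₗ[ℂ] C2),
    IsSymplecticBasis n X.form b ∧
    (∀ j i : Fin 2, φ (b (Sum.inl j)) i = symMatrix z i j) ∧
    (∀ j i : Fin 2, φ (b (Sum.inr j)) i = if i = j then (polType n i : ℂ) else 0) ∧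
    (∀ j, (X.ρ (gammaD D) : Module.End ℂ C2) (b j) = ∑ i, R i j • (b i : C2))

/-- A set of points of the moduli space is analytic if it is so in period coordinates. Surfaces
whose lattice is marked by a symplectic basis in which `γ` acts by the integral matrix `R` are
parametrized by an analytic subset of `ℍ₂`; the moduli space is the quotient of the disjoint union
of these loci over all `R` by the change of marking, and its analytic subsets are those with
analytic preimage. -/
def ModuliSpace.IsAnalytic {n : ℕ} {D : ℤ} (S : Set (ModuliSpace n D)) : Prop :=
  ∀ R : Matrix (Fin 2 ⊕ Fin 2) (Fin 2 ⊕ Fin 2) ℤ,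
    IsAnalyticSubset siegelSpace
      {z | z ∈ siegelSpace ∧ ∃ X : RMSurface n D, ModuliSpace.mk X ∈ S ∧ IsPeriod X z R}

/-- The analytic Zariski topology of the moduli space: the coarsest topology in which the analytic
subsets are closed. Its irreducible components are the irreducible components of the moduli space
as an analytic space. -/
instance (n : ℕ) (D : ℤ) : TopologicalSpace (ModuliSpace n D) :=
  TopologicalSpace.generateFrom {U | ModuliSpace.IsAnalytic Uᶜ}

end RealMult

end

noncomputable section

set_option linter.unusedSimpArgs false

open ContDiff

namespace RealMult

/-! In a symplectic basis of type `(1, n)` a self-adjoint endomorphism is given by six integers `α,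
β, c, d, e, δ`, and it satisfies a quadratic equation, whose discriminant is `(α - δ)² + 4n(βc -
de)`. For `γ` this discriminant is `D`, and properness of the action means that `β, c, d, e, α - δ`
have no common factor (`RMSurface.HasData.primitive`, `RMData.Primitive.isProperAction`).

The class of `α` modulo `n` does not depend on the basis, since `E(γv, w) ≡ α E(v, w)` modulo `n` on
the whole lattice. It is a root `a` of `a(D - a) + (D - D²)/4` modulo `n`, that is, `(2a - D)² ≡ D`
modulo `4n`. It is the only discrete invariant: unimodular changes of the pairs `λ₁, μ₁` and `λ₂,
μ₂` are row and column operations on `((c, d), (e, β))`, and together with two shears they bring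
primitive data to `c = 1`, `d = e = 0`, `α = a` (`FrameStable.exists_normal`). Trace and norm then
determine `δ` and `β`.

So all surfaces with invariant `a` have periods in one slice of `ℍ₂`, cut out by a linear equation
because `e = 0`. Conversely, every point of the slice is a period, and a period together with the
matrix of `γ` determines the surface up to isomorphism. The slice is convex, hence connected, and
non-empty as `D > 0`; by the identity theorem it is not a finite union of proper analytic subsets.
Each class is therefore irreducible (`ModuliSpace.isIrreducible_residueClass`). The classes are
closed, finite in number, disjoint and cover the moduli space, so they are its components. It
remains to count the roots `a` for `n = 6`, which depend only on `D` modulo 24. -/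

/-- The vectors `l₁, l₂, m₁, m₂` generate `Λ` and are symplectic of type `(1, n)`. -/
structure SymplecticFrame (n : ℕ) (Λ : Submodule ℤ C2) (E : LinearMap.BilinForm ℝ C2)
    (l₁ l₂ m₁ m₂ : C2) : Prop where
  mem_l₁ : l₁ ∈ Λ
  mem_l₂ : l₂ ∈ Λ
  mem_m₁ : m₁ ∈ Λ
  mem_m₂ : m₂ ∈ Λ
  l₁_l₂ : E l₁ l₂ = 0
  m₁_m₂ : E m₁ m₂ = 0
  l₁_m₁ : E l₁ m₁ = 1
  l₂_m₂ : E l₂ m₂ = n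
  l₁_m₂ : E l₁ m₂ = 0
  l₂_m₁ : E l₂ m₁ = 0
  span : ∀ v ∈ Λ, ∃ x y z w : ℤ, v = x • l₁ + y • l₂ + z • m₁ + w • m₂

/-- The integers that describe a self-adjoint endomorphism in a symplectic frame. -/
structure RMData where
  α : ℤ
  β : ℤ
  c : ℤ
  d : ℤ
  e : ℤ
  δ : ℤ

/-- The endomorphism `f` acts on the frame through the integers `t`. -/
structure ActsBy (n : ℕ) (f : Module.End ℂ C2) (t : RMData) (l₁ l₂ m₁ m₂ : C2) : Prop where
  map_l₁ : f l₁ = t.α • l₁ + t.c • l₂ + t.d • m₂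
  map_l₂ : f l₂ = (n * t.β) • l₁ + t.δ • l₂ + (-(n * t.d)) • m₁
  map_m₁ : f m₁ = t.e • l₂ + t.α • m₁ + t.β • m₂
  map_m₂ : f m₂ = (-(n * t.e)) • l₁ + (n * t.c) • m₁ + t.δ • m₂

/-- The trace of the data. -/
def RMData.tr (t : RMData) : ℤ := t.α + t.δ

/-- The norm of the data. -/
def RMData.nm (n : ℕ) (t : RMData) : ℤ := t.α * t.δ - n * t.β * t.c + n * t.d * t.e

/-! ### Self-adjoint endomorphisms in symplectic frames, and changes of frame -/

section Frames

variable {n : ℕ} {Λ : Submodule ℤ C2} {E : LinearMap.BilinForm ℝ C2} {l₁ l₂ m₁ m₂ : C2}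
  {f : Module.End ℂ C2} {t : RMData}

theorem form_swap (hE : ∀ v, E v v = 0) (v w : C2) : E w v = -E v w := by
  have h := hE (v + w)
  simp only [map_add, LinearMap.add_apply, hE] at h
  linarith

theorem form_zsmul_left (k : ℤ) (v w : C2) : E (k • v) w = k * E v w := by
  rw [map_zsmul, LinearMap.smul_apply, zsmul_eq_mul]

theorem form_zsmul_right (k : ℤ) (v w : C2) : E v (k • w) = k * E v w := by
  rw [map_zsmul, zsmul_eq_mul]

/-- Self-adjointness for an alternating form makes the characteristic polynomial of degree four a
perfect square; its square root already annihilates the endomorphism. -/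
theorem ActsBy.sq_apply (h : ActsBy n f t l₁ l₂ m₁ m₂) :
    (f (f l₁) = t.tr • f l₁ - t.nm n • l₁) ∧ (f (f l₂) = t.tr • f l₂ - t.nm n • l₂) ∧
    (f (f m₁) = t.tr • f m₁ - t.nm n • m₁) ∧ (f (f m₂) = t.tr • f m₂ - t.nm n • m₂) := by
  obtain ⟨h1, h2, h3, h4⟩ := h
  refine ⟨?_, ?_, ?_, ?_⟩
  · simp only [h1, h2, h3, h4, map_add, map_zsmul, RMData.tr, RMData.nm]; module
  · simp only [h1, h2, h3, h4, map_add, map_zsmul, RMData.tr, RMData.nm]; module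
  · simp only [h1, h2, h3, h4, map_add, map_zsmul, RMData.tr, RMData.nm]; module
  · simp only [h1, h2, h3, h4, map_add, map_zsmul, RMData.tr, RMData.nm]; module

/-- Two real-linear maps that agree on a frame of a full lattice are equal. -/
theorem SymplecticFrame.ext_real {V : Type*} [AddCommGroup V] [Module ℝ V]
    (hF : SymplecticFrame n Λ E l₁ l₂ m₁ m₂) (hΛ : Submodule.span ℝ (Λ : Set C2) = ⊤)
    {f g : C2 →ₗ[ℝ] V} (h1 : f l₁ = g l₁) (h2 : f l₂ = g l₂) (h3 : f m₁ = g m₁)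
    (h4 : f m₂ = g m₂) : f = g := by
  refine LinearMap.ext_on hΛ fun v hv => ?_
  obtain ⟨x, y, z, w, rfl⟩ := hF.span v hv
  simp only [map_add, map_zsmul, h1, h2, h3, h4]

theorem SymplecticFrame.sq_eq (hF : SymplecticFrame n Λ E l₁ l₂ m₁ m₂)
    (hΛ : Submodule.span ℝ (Λ : Set C2) = ⊤) (h : ActsBy n f t l₁ l₂ m₁ m₂) :
    f * f = t.tr • f - t.nm n • 1 := by
  have h0 : (f * f).restrictScalars ℝ = (t.tr • f - t.nm n • 1 : Module.End ℂ C2).restrictScalars ℝ := by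
    obtain ⟨h1, h2, h3, h4⟩ := h.sq_apply
    refine hF.ext_real hΛ ?_ ?_ ?_ ?_ <;> assumption
  exact LinearMap.ext fun v => LinearMap.congr_fun h0 v

/-- Pairing the relation with each frame vector isolates one coefficient, up to a factor `±1` or
`±n`. -/
theorem SymplecticFrame.eq_zero (hE : ∀ v, E v v = 0) (hn : 0 < n)
    (hF : SymplecticFrame n Λ E l₁ l₂ m₁ m₂)
    {x y z w : ℝ} (h : x • l₁ + y • l₂ + z • m₁ + w • m₂ = 0) :
    x = 0 ∧ y = 0 ∧ z = 0 ∧ w = 0 := by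
  have hn' : (n : ℝ) ≠ 0 := by positivity
  have k1 := congrArg (E l₁) h
  have k2 := congrArg (E l₂) h
  have k3 := congrArg (E m₁) h
  have k4 := congrArg (E m₂) h
  simp only [map_add, map_smul, hE, hF.l₁_l₂, hF.m₁_m₂, hF.l₁_m₁, hF.l₂_m₂, hF.l₁_m₂, hF.l₂_m₁,
    form_swap hE l₁ l₂, form_swap hE m₁ m₂, form_swap hE l₁ m₁, form_swap hE l₂ m₂,
    form_swap hE l₁ m₂, form_swap hE l₂ m₁, smul_eq_mul, map_zero] at k1 k2 k3 k4
  simp only [mul_zero, mul_one, mul_neg, zero_add, add_zero, neg_zero, neg_eq_zero,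
    mul_eq_zero, hn', or_false] at k1 k2 k3 k4
  exact ⟨k3, k4, k1, k2⟩

theorem SymplecticFrame.int_ext (hE : ∀ v, E v v = 0) (hn : 0 < n)
    (hF : SymplecticFrame n Λ E l₁ l₂ m₁ m₂) {x y z w x' y' z' w' : ℤ}
    (h : x • l₁ + y • l₂ + z • m₁ + w • m₂ = x' • l₁ + y' • l₂ + z' • m₁ + w' • m₂) :
    x = x' ∧ y = y' ∧ z = z' ∧ w = w' := by
  have h0 : ((x - x' : ℤ) : ℝ) • l₁ + ((y - y' : ℤ) : ℝ) • l₂ + ((z - z' : ℤ) : ℝ) • m₁ +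
      ((w - w' : ℤ) : ℝ) • m₂ = 0 := by
    simp only [Int.cast_smul_eq_zsmul]
    rw [← sub_eq_zero] at h
    rw [← h]; module
  obtain ⟨h1, h2, h3, h4⟩ := hF.eq_zero hE hn h0
  norm_cast at h1 h2 h3 h4
  omega

/-- A self-adjoint endomorphism that preserves the lattice acts on a frame through integers. -/
theorem SymplecticFrame.exists_actsBy (hE : ∀ v, E v v = 0) (hn : 0 < n)
    (hF : SymplecticFrame n Λ E l₁ l₂ m₁ m₂) (hf : ∀ v ∈ Λ, f v ∈ Λ)
    (hs : ∀ v w, E (f v) w = E v (f w)) : ∃ t, ActsBy n f t l₁ l₂ m₁ m₂ := by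
  have hn' : (n : ℝ) ≠ 0 := by positivity
  obtain ⟨x1, y1, z1, w1, e1⟩ := hF.span _ (hf _ hF.mem_l₁)
  obtain ⟨x2, y2, z2, w2, e2⟩ := hF.span _ (hf _ hF.mem_l₂)
  obtain ⟨x3, y3, z3, w3, e3⟩ := hF.span _ (hf _ hF.mem_m₁)
  obtain ⟨x4, y4, z4, w4, e4⟩ := hF.span _ (hf _ hF.mem_m₂)
  have a1 := hs l₁ l₁
  have a2 := hs l₂ l₂
  have a3 := hs m₁ m₁
  have a4 := hs m₂ m₂
  have a5 := hs l₁ l₂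
  have a6 := hs l₁ m₁
  have a7 := hs l₁ m₂
  have a8 := hs l₂ m₁
  have a9 := hs l₂ m₂
  have a10 := hs m₁ m₂
  simp only [e1, e2, e3, e4, map_add, LinearMap.add_apply, hE,
    hF.l₁_l₂, hF.m₁_m₂, hF.l₁_m₁, hF.l₂_m₂, hF.l₁_m₂, hF.l₂_m₁,
    form_swap hE l₁ l₂, form_swap hE m₁ m₂, form_swap hE l₁ m₁, form_swap hE l₂ m₂,
    form_swap hE l₁ m₂, form_swap hE l₂ m₁, form_zsmul_left, form_zsmul_right]
    at a1 a2 a3 a4 a5 a6 a7 a8 a9 a10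
  simp only [mul_zero, mul_one, mul_neg, zero_add, add_zero, neg_zero]
    at a1 a2 a3 a4 a5 a6 a7 a8 a9 a10
  have b1 : z1 = 0 := by have : (z1 : ℝ) = 0 := by linarith
                         exact_mod_cast this
  have b2 : w2 = 0 := by have : (w2 : ℝ) * n = 0 := by linarith
                         exact_mod_cast (mul_eq_zero.1 this).resolve_right hn'
  have b3 : x3 = 0 := by have : (x3 : ℝ) = 0 := by linarith
                         exact_mod_cast this
  have b4 : y4 = 0 := by have : (y4 : ℝ) * n = 0 := by linarith
                         exact_mod_cast (mul_eq_zero.1 this).resolve_right hn'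
  have b9 : y2 = w4 := by
    have : (y2 : ℝ) * n = w4 * n := by linarith
    exact_mod_cast mul_right_cancel₀ hn' this
  have c5 : z2 = -(n * w1) := by
    have : (z2 : ℝ) = -(n * w1) := by linarith
    exact_mod_cast this
  have c6 : x1 = z3 := by
    have : (x1 : ℝ) = z3 := by linarith
    exact_mod_cast this
  have c7 : z4 = n * y1 := by
    have : (z4 : ℝ) = n * y1 := by linarith
    exact_mod_cast this
  have c8 : x2 = n * w3 := by
    have : (x2 : ℝ) = n * w3 := by linarith
    exact_mod_cast this
  have c10 : x4 = -(n * y3) := by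
    have : (x4 : ℝ) = -(n * y3) := by linarith
    exact_mod_cast this
  refine ⟨⟨x1, w3, y1, w1, y3, y2⟩, ?_, ?_, ?_, ?_⟩
  · rw [e1, b1]; module
  · rw [e2, b2, c5, c8]; module
  · rw [e3, b3, c6]; module
  · rw [e4, b4, c7, c10, b9]; module

/-- The unimodular changes of the pair `λ₂, μ₂`. -/
theorem SymplecticFrame.change₂ (hE : ∀ v, E v v = 0) (hF : SymplecticFrame n Λ E l₁ l₂ m₁ m₂)
    (hf : ActsBy n f t l₁ l₂ m₁ m₂) {p q r s : ℤ} (h : p * s - q * r = 1) :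
    ∃ l₂' m₂', SymplecticFrame n Λ E l₁ l₂' m₁ m₂' ∧
      ActsBy n f ⟨t.α, p * t.β - r * t.e, s * t.c - q * t.d, p * t.d - r * t.c,
        s * t.e - q * t.β, t.δ⟩ l₁ l₂' m₁ m₂' := by
  have hR : (p : ℝ) * s - q * r = 1 := by exact_mod_cast h
  refine ⟨p • l₂ + r • m₂, q • l₂ + s • m₂, ⟨hF.mem_l₁, ?_, hF.mem_m₁, ?_, ?_, ?_, ?_, ?_, ?_, ?_,
    ?_⟩, ?_, ?_, ?_, ?_⟩
  · exact Λ.add_mem (Λ.smul_mem _ hF.mem_l₂) (Λ.smul_mem _ hF.mem_m₂)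
  · exact Λ.add_mem (Λ.smul_mem _ hF.mem_l₂) (Λ.smul_mem _ hF.mem_m₂)
  · simp [-zsmul_eq_mul, form_zsmul_left, form_zsmul_right, hF.l₁_l₂, hF.l₁_m₂]
  · simp [-zsmul_eq_mul, form_zsmul_left, form_zsmul_right, form_swap hE l₂ m₁, hF.l₂_m₁, hF.m₁_m₂]
  · exact hF.l₁_m₁
  · simp only [map_add, LinearMap.add_apply, hE, hF.l₂_m₂, form_swap hE l₂ m₂, form_zsmul_left,
      form_zsmul_right]
    linear_combination (n : ℝ) * hR
  · simp [-zsmul_eq_mul, form_zsmul_left, form_zsmul_right, hF.l₁_l₂, hF.l₁_m₂]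
  · simp [-zsmul_eq_mul, form_zsmul_left, form_zsmul_right, hF.l₂_m₁, form_swap hE m₁ m₂, hF.m₁_m₂]
  · intro v hv
    obtain ⟨x, y, z, w, rfl⟩ := hF.span v hv
    refine ⟨x, s * y - q * w, z, p * w - r * y, ?_⟩
    linear_combination -(h • (y • l₂ + w • m₂))
  · rw [hf.map_l₁]
    linear_combination -(h • (t.c • l₂ + t.d • m₂))
  · simp only [map_add, map_zsmul, hf.map_l₂, hf.map_m₂]
    module
  · rw [hf.map_m₁]
    linear_combination -(h • (t.e • l₂ + t.β • m₂))
  · simp only [map_add, map_zsmul, hf.map_l₂, hf.map_m₂]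
    module

/-- The unimodular changes of the pair `λ₁, μ₁`. -/
theorem SymplecticFrame.change₁ (hE : ∀ v, E v v = 0) (hF : SymplecticFrame n Λ E l₁ l₂ m₁ m₂)
    (hf : ActsBy n f t l₁ l₂ m₁ m₂) {p q r s : ℤ} (h : p * s - q * r = 1) :
    ∃ l₁' m₁', SymplecticFrame n Λ E l₁' l₂ m₁' m₂ ∧
      ActsBy n f ⟨t.α, q * t.d + s * t.β, p * t.c + r * t.e, p * t.d + r * t.β,
        q * t.c + s * t.e, t.δ⟩ l₁' l₂ m₁' m₂ := by
  have hR : (p : ℝ) * s - q * r = 1 := by exact_mod_cast h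
  refine ⟨p • l₁ + r • m₁, q • l₁ + s • m₁, ⟨?_, hF.mem_l₂, ?_, hF.mem_m₂, ?_, ?_, ?_, ?_, ?_, ?_,
    ?_⟩, ?_, ?_, ?_, ?_⟩
  · exact Λ.add_mem (Λ.smul_mem _ hF.mem_l₁) (Λ.smul_mem _ hF.mem_m₁)
  · exact Λ.add_mem (Λ.smul_mem _ hF.mem_l₁) (Λ.smul_mem _ hF.mem_m₁)
  · simp [-zsmul_eq_mul, form_zsmul_left, form_zsmul_right, hF.l₁_l₂, hF.l₂_m₁, form_swap hE l₂ m₁]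
  · simp [-zsmul_eq_mul, form_zsmul_left, form_zsmul_right, hF.l₁_m₂, hF.m₁_m₂]
  · simp only [map_add, LinearMap.add_apply, hE, hF.l₁_m₁, form_swap hE l₁ m₁, form_zsmul_left,
      form_zsmul_right]
    linear_combination hR
  · exact hF.l₂_m₂
  · simp [-zsmul_eq_mul, form_zsmul_left, form_zsmul_right, hF.l₁_m₂, hF.m₁_m₂]
  · simp [-zsmul_eq_mul, form_zsmul_left, form_zsmul_right, hF.l₂_m₁, form_swap hE l₁ l₂, hF.l₁_l₂]
  · intro v hv
    obtain ⟨x, y, z, w, rfl⟩ := hF.span v hv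
    refine ⟨s * x - q * z, y, p * z - r * x, w, ?_⟩
    linear_combination -(h • (x • l₁ + z • m₁))
  · simp only [map_add, map_zsmul, hf.map_l₁, hf.map_m₁]
    module
  · rw [hf.map_l₂]
    linear_combination -(h • ((n * t.β) • l₁ + (-(n * t.d)) • m₁))
  · simp only [map_add, map_zsmul, hf.map_l₁, hf.map_m₁]
    module
  · rw [hf.map_m₂]
    linear_combination -(h • ((-(n * t.e)) • l₁ + (n * t.c) • m₁))

/-- The change of frame `λ₁ ↦ λ₁ + kλ₂`, `μ₂ ↦ μ₂ - knμ₁`. -/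
theorem SymplecticFrame.shear₁ (hE : ∀ v, E v v = 0) (hF : SymplecticFrame n Λ E l₁ l₂ m₁ m₂)
    (hf : ActsBy n f t l₁ l₂ m₁ m₂) (k : ℤ) :
    ∃ l₁' m₂', SymplecticFrame n Λ E l₁' l₂ m₁ m₂' ∧
      ActsBy n f ⟨t.α + k * n * t.β, t.β, t.c + k * (t.δ - t.α) - k ^ 2 * n * t.β, t.d, t.e,
        t.δ - k * n * t.β⟩ l₁' l₂ m₁ m₂' := by
  refine ⟨l₁ + k • l₂, m₂ - (k * n) • m₁, ⟨?_, hF.mem_l₂, hF.mem_m₁, ?_, ?_, ?_, ?_, ?_, ?_, ?_,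
    ?_⟩, ?_, ?_, ?_, ?_⟩
  · exact Λ.add_mem hF.mem_l₁ (Λ.smul_mem _ hF.mem_l₂)
  · exact Λ.sub_mem hF.mem_m₂ (Λ.smul_mem _ hF.mem_m₁)
  · simp [-zsmul_eq_mul, form_zsmul_left, form_zsmul_right, hF.l₁_l₂, hE]
  · simp [-zsmul_eq_mul, form_zsmul_left, form_zsmul_right, hF.m₁_m₂, hE]
  · simp [-zsmul_eq_mul, form_zsmul_left, form_zsmul_right, hF.l₁_m₁, hF.l₂_m₁]
  · simp [-zsmul_eq_mul, form_zsmul_left, form_zsmul_right, hF.l₂_m₂, hF.l₂_m₁]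
  · simp [-zsmul_eq_mul, form_zsmul_left, form_zsmul_right, hF.l₁_m₁, hF.l₁_m₂, hF.l₂_m₂, hF.l₂_m₁]
    rw [zsmul_eq_mul]; ring
  · exact hF.l₂_m₁
  · intro v hv
    obtain ⟨x, y, z, w, rfl⟩ := hF.span v hv
    exact ⟨x, y - k * x, z + k * n * w, w, by module⟩
  · simp only [map_add, map_sub, map_zsmul, hf.map_l₁, hf.map_l₂]
    module
  · simp only [hf.map_l₂]
    module
  · simp only [hf.map_m₁]
    module
  · simp only [map_add, map_sub, map_zsmul, hf.map_m₁, hf.map_m₂]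
    module

/-- The change of frame `λ₂ ↦ λ₂ + nkλ₁`, `μ₁ ↦ μ₁ - kμ₂`. -/
theorem SymplecticFrame.shear₂ (hE : ∀ v, E v v = 0) (hF : SymplecticFrame n Λ E l₁ l₂ m₁ m₂)
    (hf : ActsBy n f t l₁ l₂ m₁ m₂) (k : ℤ) :
    ∃ l₂' m₁', SymplecticFrame n Λ E l₁ l₂' m₁' m₂ ∧
      ActsBy n f ⟨t.α - n * k * t.c, t.β + k * (t.α - t.δ) - n * k ^ 2 * t.c, t.c, t.d, t.e,
        t.δ + n * k * t.c⟩ l₁ l₂' m₁' m₂ := by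
  refine ⟨l₂ + (n * k) • l₁, m₁ - k • m₂, ⟨hF.mem_l₁, ?_, ?_, hF.mem_m₂, ?_, ?_, ?_, ?_, ?_, ?_,
    ?_⟩, ?_, ?_, ?_, ?_⟩
  · exact Λ.add_mem hF.mem_l₂ (Λ.smul_mem _ hF.mem_l₁)
  · exact Λ.sub_mem hF.mem_m₁ (Λ.smul_mem _ hF.mem_m₂)
  · simp [-zsmul_eq_mul, form_zsmul_left, form_zsmul_right, hF.l₁_l₂, hE]
  · simp [-zsmul_eq_mul, form_zsmul_left, form_zsmul_right, hF.m₁_m₂, hE]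
  · simp [-zsmul_eq_mul, form_zsmul_left, form_zsmul_right, hF.l₁_m₁, hF.l₁_m₂]
  · simp [-zsmul_eq_mul, form_zsmul_left, form_zsmul_right, hF.l₂_m₂, hF.l₁_m₂]
  · exact hF.l₁_m₂
  · simp [-zsmul_eq_mul, form_zsmul_left, form_zsmul_right, hF.l₁_m₁, hF.l₁_m₂, hF.l₂_m₂, hF.l₂_m₁]; ring
  · intro v hv
    obtain ⟨x, y, z, w, rfl⟩ := hF.span v hv
    exact ⟨x - n * k * y, y, z, w + k * z, by module⟩
  · simp only [hf.map_l₁]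
    module
  · simp only [map_add, map_sub, map_zsmul, hf.map_l₁, hf.map_l₂]
    module
  · simp only [map_add, map_sub, map_zsmul, hf.map_m₁, hf.map_m₂]
    module
  · simp only [hf.map_m₂]
    module

end Frames

/-! ### Reduction of the integral data to a normal form -/

theorem exists_isCoprime_add_mul {c b β : ℤ} (h : IsCoprime c b) (hβ : β ≠ 0) :
    ∃ j, IsCoprime (c + j * b) β := by
  -- `j` is the product of the primes that divide `β` but not `c`. A prime of `β` dividing `c`
  -- divides neither `j` nor `b`; one not dividing `c` divides `j * b`.
  refine ⟨∏ p ∈ β.natAbs.primeFactors.filter fun p : ℕ => ¬ ((p : ℤ) ∣ c), (p : ℤ), ?_⟩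
  rw [Int.isCoprime_iff_gcd_eq_one]
  refine Nat.Coprime.gcd_eq_one <| Nat.coprime_of_dvd fun p hp hpc hpβ => ?_
  have hp' : Prime (p : ℤ) := Nat.prime_iff_prime_int.1 hp
  rw [← Int.natCast_dvd] at hpc
  by_cases hc : (p : ℤ) ∣ c
  · rcases hp'.dvd_or_dvd ((dvd_add_right hc).1 hpc) with h1 | h1
    · obtain ⟨q, hq, hpq⟩ := (hp'.dvd_finsetProd_iff _).1 h1
      rw [Finset.mem_filter] at hq
      rw [Int.natCast_dvd_natCast, Nat.prime_dvd_prime_iff_eq hp (Nat.prime_of_mem_primeFactors hq.1)]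
        at hpq
      exact hq.2 (hpq ▸ hc)
    · exact hp'.not_isUnit (h.isUnit_of_dvd' hc h1)
  · refine hc ((dvd_add_left (Dvd.dvd.mul_right (Finset.dvd_prod_of_mem _ ?_) b)).1 hpc)
    rw [Finset.mem_filter, Nat.mem_primeFactors]
    exact ⟨⟨hp, hpβ, by simpa using hβ⟩, hc⟩

/-- A property of data that is stable under the changes of symplectic frame. -/
structure FrameStable (n : ℕ) (P : RMData → Prop) : Prop where
  change₂ : ∀ t, P t → ∀ p q r s : ℤ, p * s - q * r = 1 →
    P ⟨t.α, p * t.β - r * t.e, s * t.c - q * t.d, p * t.d - r * t.c, s * t.e - q * t.β, t.δ⟩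
  change₁ : ∀ t, P t → ∀ p q r s : ℤ, p * s - q * r = 1 →
    P ⟨t.α, q * t.d + s * t.β, p * t.c + r * t.e, p * t.d + r * t.β, q * t.c + s * t.e, t.δ⟩
  shear₁ : ∀ t, P t → ∀ k : ℤ, P ⟨t.α + k * n * t.β, t.β,
    t.c + k * (t.δ - t.α) - k ^ 2 * n * t.β, t.d, t.e, t.δ - k * n * t.β⟩
  shear₂ : ∀ t, P t → ∀ k : ℤ, P ⟨t.α - n * k * t.c,
    t.β + k * (t.α - t.δ) - n * k ^ 2 * t.c, t.c, t.d, t.e, t.δ + n * k * t.c⟩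

/-- The discriminant of the data. -/
theorem RMData.disc_eq (n : ℕ) (t : RMData) :
    t.tr ^ 2 - 4 * t.nm n = (t.α - t.δ) ^ 2 + 4 * n * t.β * t.c - 4 * n * t.d * t.e := by
  unfold RMData.tr RMData.nm; ring

/-- No integer other than a unit divides all the entries of the data. -/
def RMData.Primitive (t : RMData) : Prop :=
  ∀ m : ℤ, m ∣ t.β → m ∣ t.c → m ∣ t.d → m ∣ t.e → m ∣ t.α - t.δ → IsUnit m

/-- Some data in a stable property have a diagonal off-diagonal block, the first entry of which
divides the second. -/
theorem FrameStable.exists_diagonal {n : ℕ} {P : RMData → Prop} (hP : FrameStable n P)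
    (hsq : ∀ t, P t → ¬ IsSquare (t.tr ^ 2 - 4 * t.nm n)) {t : RMData} (ht : P t) :
    ∃ t', P t' ∧ t'.d = 0 ∧ t'.e = 0 ∧ t'.c ∣ t'.β := by
  -- The argument is that of the Smith normal form of `((c, d), (e, β))`: `change₁` acts by row
  -- operations, `change₂` by column operations, all of determinant one. The pivot is the least
  -- positive value of `c` over all data in `P`.
  have pos : ∀ t, P t → t.c ≠ 0 → ∃ t', P t' ∧ 0 < t'.c ∧ t'.c = |t.c| := by
    intro t ht hc
    rcases lt_or_gt_of_ne hc with h | h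
    · have h' := hP.change₂ t ht (-1) 0 0 (-1) (by norm_num)
      refine ⟨_, h', ?_, ?_⟩
      · show 0 < -1 * t.c - 0 * t.d
        linarith
      · rw [abs_of_neg h]; show -1 * t.c - 0 * t.d = _
        ring
    · exact ⟨t, ht, h, (abs_of_pos h).symm⟩
  have swap₂ : ∀ t, P t → P ⟨t.α, -t.e, t.d, -t.c, t.β, t.δ⟩ := fun t ht => by
    have h := hP.change₂ t ht 0 (-1) 1 0 (by norm_num)
    simpa using h
  have swap₁ : ∀ t, P t → P ⟨t.α, -t.d, t.e, t.β, -t.c, t.δ⟩ := fun t ht => by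
    have h := hP.change₁ t ht 0 (-1) 1 0 (by norm_num)
    simpa using h
  have ex : ∃ k : ℕ, 0 < k ∧ ∃ t, P t ∧ t.c = k := by
    have key : ∃ t, P t ∧ t.c ≠ 0 := by
      by_contra! H
      have h1 := H t ht
      have h2 : t.d = 0 := H _ (swap₂ t ht)
      refine hsq t ht ⟨t.α - t.δ, ?_⟩
      rw [RMData.disc_eq, h1, h2]
      ring
    obtain ⟨t, ht, hc⟩ := key
    obtain ⟨t', ht', h1, h2⟩ := pos t ht hc
    exact ⟨t'.c.toNat, by omega, t', ht', by omega⟩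
  classical
  obtain ⟨hk, t, ht, hc⟩ := Nat.find_spec ex
  have hmin : ∀ t, P t → t.c ≠ 0 → (Nat.find ex : ℤ) ≤ |t.c| := by
    intro t ht hc
    obtain ⟨t', ht', h1, h2⟩ := pos t ht hc
    have := Nat.find_min' ex (m := t'.c.toNat) ⟨by omega, t', ht', by omega⟩
    omega
  generalize Nat.find ex = k at *
  have hk' : (k : ℤ) ≠ 0 := by omega
  have small : ∀ t, P t → 0 ≤ t.c → t.c < k → t.c = 0 := by
    intro t ht h0 h1
    by_contra h
    have := hmin t ht h
    rw [abs_of_nonneg h0] at this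
    omega
  -- A column operation replaces `d` by its remainder modulo the pivot; a swap puts that remainder
  -- in the place of `c`, so minimality makes it zero.
  have red_d : ∀ t, P t → t.c = k →
      P ⟨t.α, t.β - t.d / k * t.e, t.c, 0, t.e, t.δ⟩ ∧ (k : ℤ) ∣ t.d := by
    intro t ht hc
    have h := hP.change₂ t ht 1 0 (t.d / k) 1 (by ring)
    have e1 : 1 * t.d - t.d / k * t.c = t.d % k := by
      rw [hc, Int.emod_def]; ring
    have e2 : t.d % k = 0 := by
      have := small _ (swap₂ _ h)
      simp only [e1] at this
      exact this (Int.emod_nonneg _ hk') (Int.emod_lt_of_pos _ (by omega))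
    refine ⟨?_, Int.dvd_of_emod_eq_zero e2⟩
    rw [e1, e2] at h
    simpa using h
  obtain ⟨h1, -⟩ := red_d t ht hc
  generalize ht1 : (⟨t.α, t.β - t.d / k * t.e, t.c, 0, t.e, t.δ⟩ : RMData) = t1 at h1
  have hc1 : t1.c = k := by rw [← ht1]; exact hc
  have hd1 : t1.d = 0 := by rw [← ht1]
  have h2 := hP.change₁ t1 h1 1 (-(t1.e / k)) 0 1 (by ring)
  have e1 : -(t1.e / k) * t1.c + 1 * t1.e = t1.e % k := by
    rw [hc1, Int.emod_def]; ring
  have e2 : t1.e % k = 0 := by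
    have := small _ (swap₁ _ h2)
    simp only [e1] at this
    exact this (Int.emod_nonneg _ hk') (Int.emod_lt_of_pos _ (by omega))
  rw [e1, e2, hd1] at h2
  refine ⟨_, h2, by simp, by simp, ?_⟩
  -- Adding the second row to the first puts `β` in the place of `d` and leaves the pivot alone, so
  -- the pivot divides `β` as well.
  have h3 := (red_d _ (hP.change₁ _ h2 1 0 1 1 (by ring)) (by simpa using hc1)).2
  simpa [hc1] using h3

/-- Primitive data of non-square discriminant can be brought into a normal form. -/
theorem FrameStable.exists_normal {n : ℕ} {P : RMData → Prop} (hP : FrameStable n P)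
    (hsq : ∀ t, P t → ¬ IsSquare (t.tr ^ 2 - 4 * t.nm n)) (hprim : ∀ t, P t → t.Primitive)
    {a : ℤ} (ha : ∀ t, P t → (n : ℤ) ∣ t.α - a) {t : RMData} (ht : P t) :
    ∃ t', P t' ∧ t'.d = 0 ∧ t'.e = 0 ∧ t'.c = 1 ∧ t'.α = a := by
  obtain ⟨t, ht, hd, he, hcβ⟩ := hP.exists_diagonal hsq ht
  have hβ : t.β ≠ 0 := by
    intro h
    refine hsq t ht ⟨t.α - t.δ, ?_⟩
    rw [RMData.disc_eq, h, hd]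
    ring
  -- As `c` divides `β` and `d = e = 0`, a common divisor of `c` and `δ - α` divides all entries,
  -- and primitivity applies.
  have hcop : IsCoprime t.c (t.δ - t.α) := by
    rw [Int.isCoprime_iff_gcd_eq_one]
    have h1 : ((Int.gcd t.c (t.δ - t.α) : ℕ) : ℤ) ∣ t.c := Int.gcd_dvd_left ..
    have h2 : ((Int.gcd t.c (t.δ - t.α) : ℕ) : ℤ) ∣ t.δ - t.α := Int.gcd_dvd_right ..
    have := hprim t ht _ (h1.trans hcβ) h1 (by simp [hd]) (by simp [he])
      (by rwa [← dvd_neg, neg_sub])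
    exact Int.ofNat_isUnit.1 this |> Nat.isUnit_iff.1
  -- The shear by `j` keeps `β` and changes `c` to `c + j(δ - α)` up to a multiple of `β`, so it can
  -- make the diagonal entries `c'` and `β` coprime.
  obtain ⟨j, hj⟩ := exists_isCoprime_add_mul hcop hβ
  have h1 := hP.shear₁ t ht j
  have hj' : IsCoprime (t.c + j * (t.δ - t.α) - j ^ 2 * n * t.β) t.β := by
    have := hj.add_mul_right_left (-(j ^ 2 * n))
    convert! this using 1
    ring
  rw [hd, he] at h1
  generalize t.c + j * (t.δ - t.α) - j ^ 2 * n * t.β = c' at h1 hj'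
  obtain ⟨x, y, hxy⟩ := hj'
  -- The row operation gives the first row `(c', β)`; the Bézout coefficients `x, y` then turn it
  -- into `(1, 0)` by a column operation. The next `change₁` clears `e`.
  have h2 := hP.change₂ _ (hP.change₁ _ h1 1 0 1 1 (by ring)) c' (-y) t.β x (by linarith)
  simp only [one_mul, zero_mul, zero_add, add_zero, mul_zero] at h2
  rw [show x * c' - -y * t.β = 1 by linarith, show c' * t.β - t.β * c' = 0 by ring] at h2
  have h3 := hP.change₁ _ h2 1 (-(0 - -y * t.β)) 0 1 (by ring)
  simp only [mul_one, mul_zero, zero_mul, add_zero, one_mul, neg_add_cancel] at h3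
  obtain ⟨k, hk⟩ := ha _ h3
  -- With `c = 1` this shear moves `α` by exactly `-n * k`, hence to `a`.
  refine ⟨_, hP.shear₂ _ h3 k, rfl, rfl, rfl, ?_⟩
  simp only [mul_one] at hk ⊢
  linarith

/-! ### The data of a surface with real multiplication; properness and the residue -/

variable {n : ℕ} {D : ℤ}

/-- The endomorphism by which `γ` acts. -/
def RMSurface.gamma (X : RMSurface n D) : Module.End ℂ C2 := (X.ρ (gammaD D) : Module.End ℂ C2)

theorem RMSurface.gamma_mem (X : RMSurface n D) {v : C2} (hv : v ∈ X.lattice) :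
    X.gamma v ∈ X.lattice := (X.ρ (gammaD D)).2 v hv

theorem quadOrder_eq (x : QuadOrder D) : x = (x.re : QuadOrder D) + (x.im : QuadOrder D) * gammaD D := by
  ext <;> simp [gammaD]

theorem ringHom_quadOrder_apply {S : Type*} [Ring S] (f : QuadOrder D →+* S) (x : QuadOrder D) :
    f x = (x.re : S) + (x.im : S) * f (gammaD D) := by
  conv_lhs => rw [quadOrder_eq x]
  rw [map_add, map_mul, map_intCast, map_intCast]

theorem gammaD_mul_self : gammaD D * gammaD D = (((D - D ^ 2) / 4 : ℤ) : QuadOrder D) +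
    (D : QuadOrder D) * gammaD D := by
  ext <;> simp [gammaD]

theorem RMSurface.rho_coe (X : RMSurface n D) (x : QuadOrder D) :
    (X.ρ x : Module.End ℂ C2) = (x.re : Module.End ℂ C2) + (x.im : Module.End ℂ C2) * X.gamma := by
  rw [ringHom_quadOrder_apply X.ρ x]
  rfl

theorem RMSurface.gamma_mul_self (X : RMSurface n D) :
    X.gamma * X.gamma = ((D - D ^ 2) / 4 : ℤ) • 1 + D • X.gamma := by
  have h := congrArg X.ρ (gammaD_mul_self (D := D))
  rw [map_mul, map_add, map_mul, map_intCast, map_intCast] at h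
  have h' := congrArg Subtype.val h
  simpa [RMSurface.gamma] using h'

theorem RMSurface.eq_zero_of_gamma (X : RMSurface n D) {x y : ℤ} (h : x • (1 : Module.End ℂ C2) +
    y • X.gamma = 0) : x = 0 ∧ y = 0 := by
  have h1 : X.ρ ⟨x, y⟩ = X.ρ 0 := by
    apply Subtype.ext
    rw [X.rho_coe, map_zero]
    simpa using h
  have := X.injective h1
  exact ⟨congrArg QuadraticAlgebra.re this, congrArg QuadraticAlgebra.im this⟩

/-- `γ` acts through the data `t` in some symplectic frame of the surface. -/
def RMSurface.HasData (X : RMSurface n D) (t : RMData) : Prop :=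
  ∃ l₁ l₂ m₁ m₂, SymplecticFrame n X.lattice X.form l₁ l₂ m₁ m₂ ∧ ActsBy n X.gamma t l₁ l₂ m₁ m₂

theorem IsSymplecticBasis.frame {Λ : Submodule ℤ C2} {E : LinearMap.BilinForm ℝ C2}
    {b : Module.Basis (Fin 2 ⊕ Fin 2) ℤ Λ} (h : IsSymplecticBasis n E b) :
    SymplecticFrame n Λ E (b (Sum.inl 0)) (b (Sum.inl 1)) (b (Sum.inr 0)) (b (Sum.inr 1)) where
  mem_l₁ := (b _).2
  mem_l₂ := (b _).2
  mem_m₁ := (b _).2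
  mem_m₂ := (b _).2
  l₁_l₂ := (h 0 1).1
  m₁_m₂ := (h 0 1).2.1
  l₁_m₁ := by simpa [polType] using (h 0 0).2.2.1
  l₂_m₂ := by simpa [polType] using (h 1 1).2.2.1
  l₁_m₂ := by simpa using (h 0 1).2.2.1
  l₂_m₁ := by simpa using (h 1 0).2.2.1
  span v hv := by
    refine ⟨b.repr ⟨v, hv⟩ (Sum.inl 0), b.repr ⟨v, hv⟩ (Sum.inl 1), b.repr ⟨v, hv⟩ (Sum.inr 0),
      b.repr ⟨v, hv⟩ (Sum.inr 1), ?_⟩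
    have := congrArg Subtype.val (b.sum_repr ⟨v, hv⟩)
    simp only [Fintype.sum_sum_type, Fin.sum_univ_two, Submodule.coe_add, Submodule.coe_smul] at this
    rw [← add_assoc] at this
    exact this.symm

theorem SymplecticFrame.exists_basis {Λ : Submodule ℤ C2} {E : LinearMap.BilinForm ℝ C2}
    {l₁ l₂ m₁ m₂ : C2} (hE : ∀ v, E v v = 0) (hn : 0 < n)
    (hF : SymplecticFrame n Λ E l₁ l₂ m₁ m₂) :
    ∃ b : Module.Basis (Fin 2 ⊕ Fin 2) ℤ Λ, IsSymplecticBasis n E b ∧ (b (Sum.inl 0) : C2) = l₁ ∧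
      (b (Sum.inl 1) : C2) = l₂ ∧ (b (Sum.inr 0) : C2) = m₁ ∧ (b (Sum.inr 1) : C2) = m₂ := by
  let v : Fin 2 ⊕ Fin 2 → Λ := Sum.elim ![⟨l₁, hF.mem_l₁⟩, ⟨l₂, hF.mem_l₂⟩]
    ![⟨m₁, hF.mem_m₁⟩, ⟨m₂, hF.mem_m₂⟩]
  have hli : LinearIndependent ℤ v := by
    rw [Fintype.linearIndependent_iff]
    intro g hg
    have hg' := congrArg Subtype.val hg
    simp only [Fintype.sum_sum_type, Fin.sum_univ_two, Submodule.coe_add, Submodule.coe_smul, v,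
      Sum.elim_inl, Sum.elim_inr, Matrix.cons_val_zero, Matrix.cons_val_one,
      Submodule.coe_zero] at hg'
    rw [← add_assoc] at hg'
    obtain ⟨h1, h2, h3, h4⟩ := hF.int_ext hE hn (x' := 0) (y' := 0) (z' := 0) (w' := 0)
      (hg'.trans (by simp))
    rintro (i | i) <;> fin_cases i <;> assumption
  have hsp : ⊤ ≤ Submodule.span ℤ (Set.range v) := by
    rintro ⟨u, hu⟩ -
    obtain ⟨x, y, z, w, rfl⟩ := hF.span u hu
    have : (⟨x • l₁ + y • l₂ + z • m₁ + w • m₂, hu⟩ : Λ) =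
      x • v (Sum.inl 0) + y • v (Sum.inl 1) + z • v (Sum.inr 0) + w • v (Sum.inr 1) := rfl
    rw [this]
    have h (i) : v i ∈ Submodule.span ℤ (Set.range v) := Submodule.subset_span ⟨i, rfl⟩
    exact add_mem (add_mem (add_mem (Submodule.smul_mem _ _ (h _)) (Submodule.smul_mem _ _ (h _)))
      (Submodule.smul_mem _ _ (h _))) (Submodule.smul_mem _ _ (h _))
  refine ⟨Module.Basis.mk hli hsp, ?_, by simp [v], by simp [v], by simp [v], by simp [v]⟩
  intro i j
  simp only [Module.Basis.mk_apply, v]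
  fin_cases i <;> fin_cases j <;>
    simp [hE, hF.l₁_l₂, hF.m₁_m₂, hF.l₁_m₁, hF.l₂_m₂, hF.l₁_m₂, hF.l₂_m₁,
      form_swap hE l₁ l₂, form_swap hE m₁ m₂, form_swap hE l₁ m₁, form_swap hE l₂ m₂,
      form_swap hE l₁ m₂, form_swap hE l₂ m₁, polType]

theorem RMSurface.exists_hasData (hn : 0 < n) (X : RMSurface n D) : ∃ t, X.HasData t := by
  obtain ⟨b, hb⟩ := X.hasType
  obtain ⟨t, ht⟩ := hb.frame.exists_actsBy X.alternating hn (fun _ => X.gamma_mem)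
    (X.selfAdjoint (gammaD D))
  exact ⟨t, _, _, _, _, hb.frame, ht⟩

/-- Both `𝒪_D` and the data give a monic quadratic equation for `γ`; they agree because `1` and `γ`
are linearly independent over `ℤ`. -/
theorem RMSurface.HasData.tr_nm {X : RMSurface n D} {t : RMData} (h : X.HasData t) :
    t.tr = D ∧ t.nm n = -((D - D ^ 2) / 4) := by
  obtain ⟨l₁, l₂, m₁, m₂, hF, hA⟩ := h
  have h1 := hF.sq_eq X.span_eq_top hA
  rw [X.gamma_mul_self] at h1
  have h2 : (t.nm n + (D - D ^ 2) / 4) • (1 : Module.End ℂ C2) + (D - t.tr) • X.gamma = 0 := by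
    rw [← sub_eq_zero] at h1
    rw [← h1]; module
  have := X.eq_zero_of_gamma h2
  omega

theorem four_dvd_sub_sq (hdisc : D ≡ 0 [ZMOD 4] ∨ D ≡ 1 [ZMOD 4]) :
    4 * ((D - D ^ 2) / 4) = D - D ^ 2 := by
  refine Int.mul_ediv_cancel' ?_
  have : D % 4 = 0 ∨ D % 4 = 1 := hdisc
  obtain ⟨k, hk⟩ : ∃ k, D = 4 * k ∨ D = 4 * k + 1 := ⟨D / 4, by omega⟩
  rcases hk with rfl | rfl
  · exact ⟨k - 4 * k ^ 2, by ring⟩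
  · exact ⟨-k - 4 * k ^ 2, by ring⟩

theorem RMSurface.HasData.disc (hdisc : D ≡ 0 [ZMOD 4] ∨ D ≡ 1 [ZMOD 4]) {X : RMSurface n D}
    {t : RMData} (h : X.HasData t) : t.tr ^ 2 - 4 * t.nm n = D := by
  rw [h.tr_nm.1, h.tr_nm.2, mul_neg, four_dvd_sub_sq hdisc]
  ring

theorem ActsBy.map_mem {Λ : Submodule ℤ C2} {E : LinearMap.BilinForm ℝ C2} {l₁ l₂ m₁ m₂ : C2}
    {f : Module.End ℂ C2} {t : RMData} (hA : ActsBy n f t l₁ l₂ m₁ m₂)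
    (hF : SymplecticFrame n Λ E l₁ l₂ m₁ m₂) {v : C2} (hv : v ∈ Λ) : f v ∈ Λ := by
  have key : ∀ x y z w : ℤ, x • l₁ + y • l₂ + z • m₁ + w • m₂ ∈ Λ := fun x y z w =>
    add_mem (add_mem (add_mem (Λ.smul_mem _ hF.mem_l₁) (Λ.smul_mem _ hF.mem_l₂))
      (Λ.smul_mem _ hF.mem_m₁)) (Λ.smul_mem _ hF.mem_m₂)
  obtain ⟨x, y, z, w, rfl⟩ := hF.span v hv
  convert key (x * t.α + y * (n * t.β) - w * (n * t.e)) (x * t.c + y * t.δ + z * t.e)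
    (-(y * (n * t.d)) + z * t.α + w * (n * t.c)) (x * t.d + z * t.β + w * t.δ) using 1
  simp only [map_add, map_zsmul, hA.map_l₁, hA.map_l₂, hA.map_m₁, hA.map_m₂]
  module

/-- The ring homomorphism out of a quadratic order given by the image of `γ`. -/
theorem exists_ringHom_quadOrder {S : Type*} [Ring S] {E : ℤ} (u : S)
    (hu : u * u = ((E - E ^ 2) / 4) • 1 + E • u) :
    ∃ f : QuadOrder E →+* S, f (gammaD E) = u := by
  refine ⟨(QuadraticAlgebra.lift ⟨u, hu⟩ : QuadOrder E →ₐ[ℤ] S), ?_⟩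
  simp [gammaD, QuadraticAlgebra.lift]

theorem ringHom_quadOrder_ext {S : Type*} [Ring S] {f g : QuadOrder D →+* S}
    (h : f (gammaD D) = g (gammaD D)) : f = g := by
  ext x
  rw [ringHom_quadOrder_apply f, ringHom_quadOrder_apply g, h]

/-- If `m` divides all entries, then `(γ - δ) / m` still preserves the lattice and generates an
action of the order of discriminant `E = D / m²` that extends the given one. Properness then forces
`m = ±1`. -/
theorem RMSurface.HasData.primitive (hdisc : D ≡ 0 [ZMOD 4] ∨ D ≡ 1 [ZMOD 4]) {X : RMSurface n D}
    {t : RMData} (h : X.HasData t) : t.Primitive := by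
  have htr := h.tr_nm.1
  have hD := h.disc hdisc
  obtain ⟨l₁, l₂, m₁, m₂, hF, hA⟩ := h
  rintro m ⟨β, hβ⟩ ⟨c, hc⟩ ⟨d, hd⟩ ⟨e, he⟩ ⟨a, ha⟩
  -- For `m = 0` the endomorphism `γ` would be a scalar, against the injectivity of `ρ`.
  have hm : m ≠ 0 := by
    rintro rfl
    have h0 : ActsBy n (t.α • 1 : Module.End ℂ C2) t l₁ l₂ m₁ m₂ := by
      have hδ : t.δ = t.α := by linarith
      constructor <;> simp [hβ, hc, hd, he, hδ]
    have h1 : X.gamma.restrictScalars ℝ = (t.α • 1 : Module.End ℂ C2).restrictScalars ℝ :=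
      hF.ext_real X.span_eq_top (hA.map_l₁.trans h0.map_l₁.symm) (hA.map_l₂.trans h0.map_l₂.symm)
        (hA.map_m₁.trans h0.map_m₁.symm) (hA.map_m₂.trans h0.map_m₂.symm)
    have h2 : X.gamma = t.α • 1 := LinearMap.ext fun v => LinearMap.congr_fun h1 v
    have := (X.eq_zero_of_gamma (x := -t.α) (y := 1) (by rw [h2]; module)).2
    omega
  have hmC : (m : ℂ) ≠ 0 := by exact_mod_cast hm
  set f : Module.End ℂ C2 := (m : ℂ)⁻¹ • (X.gamma - t.δ • 1) with hf
  have hmf : m • f = X.gamma - t.δ • 1 := by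
    rw [hf, ← Int.cast_smul_eq_zsmul ℂ, smul_smul, mul_inv_cancel₀ hmC, one_smul]
  have happ : ∀ v w : C2, X.gamma v - t.δ • v = m • w → f v = w := by
    intro v w hvw
    rw [hf, LinearMap.smul_apply, LinearMap.sub_apply, LinearMap.smul_apply, Module.End.one_apply,
      hvw, ← Int.cast_smul_eq_zsmul ℂ, smul_smul, inv_mul_cancel₀ hmC, one_smul]
  set s : RMData := ⟨a, β, c, d, e, 0⟩ with hs
  have hfs : ActsBy n f s l₁ l₂ m₁ m₂ := by
    have hα : t.α = t.δ + m * a := by linarith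
    constructor
    · refine happ _ _ ?_
      rw [hA.map_l₁, hα, hc, hd]; module
    · refine happ _ _ ?_
      rw [hA.map_l₂, hβ, hd]; module
    · refine happ _ _ ?_
      rw [hA.map_m₁, hα, he, hβ]; module
    · refine happ _ _ ?_
      rw [hA.map_m₂, he, hc]; module
  have hsq := hF.sq_eq X.span_eq_top hfs
  obtain ⟨E, hE⟩ : ∃ E, E = s.tr ^ 2 - 4 * s.nm n := ⟨_, rfl⟩
  have hE4 : E ≡ 0 [ZMOD 4] ∨ E ≡ 1 [ZMOD 4] := by
    have : E % 4 = s.tr ^ 2 % 4 := by omega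
    rcases Int.even_or_odd' s.tr with ⟨k, hk | hk⟩ <;> rw [hk] at this
    · left; show E % 4 = 0
      rw [this, show (2 * k) ^ 2 = 4 * k ^ 2 by ring]; omega
    · right; show E % 4 = 1
      rw [this, show (2 * k + 1) ^ 2 = 4 * (k ^ 2 + k) + 1 by ring]; omega
  have hE4' := four_dvd_sub_sq hE4
  have hDE : D = m ^ 2 * E := by
    rw [← hD, hE, RMData.disc_eq, RMData.disc_eq, ha, hβ, hc, hd, he]
    ring
  -- The generator of `𝒪_E` has trace `E`, so `f` must be translated by half of `E - s.tr`, an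
  -- integer since `E ≡ s.tr` modulo 2.
  obtain ⟨k, hk⟩ : ∃ k, E = 2 * k + s.tr := by
    have h1 : Even (E - s.tr) := by
      rw [hE, show s.tr ^ 2 - 4 * s.nm n - s.tr = (s.tr ^ 2 - s.tr) - 2 * (2 * s.nm n) by ring]
      refine Even.sub ?_ (even_two_mul _)
      rw [show s.tr ^ 2 - s.tr = (s.tr - 1) * (s.tr - 1 + 1) by ring]
      exact Int.even_mul_succ_self _
    obtain ⟨k, hk⟩ := h1
    exact ⟨k, by linarith⟩
  have hDm : D = 2 * t.δ + m * s.tr := by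
    rw [← htr]; simp only [RMData.tr, hs]; linarith
  let u : X.endRing := ⟨f + k • 1, fun v hv => by
    rw [LinearMap.add_apply, LinearMap.smul_apply]
    exact add_mem (hfs.map_mem hF hv) (X.lattice.smul_mem _ hv)⟩
  have hu : u * u = ((E - E ^ 2) / 4) • 1 + E • u := by
    apply Subtype.ext
    show (f + k • 1) * (f + k • 1) = ((E - E ^ 2) / 4) • (1 : Module.End ℂ C2) + E • (f + k • 1)
    have e1 : (f + k • (1 : Module.End ℂ C2)) * (f + k • 1) = f * f + (2 * k) • f + (k * k) • 1 := by
      simp only [mul_add, add_mul, mul_smul_comm, smul_mul_assoc, mul_one, one_mul]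
      module
    have e2 : (E - E ^ 2) / 4 = -s.nm n + k * k - E * k := by
      have : 4 * ((E - E ^ 2) / 4) = 4 * (-s.nm n + k * k - E * k) := by
        rw [hE4']
        have h1 : s.tr = E - 2 * k := by linarith
        rw [h1] at hE
        linear_combination hE
      linarith
    rw [e1, e2, hsq, hk]
    module
  obtain ⟨ρ', hρ'⟩ := exists_ringHom_quadOrder u hu
  -- The inclusion is read off from `γ = m f + δ` with `f + k` in the role of the generator of
  -- `𝒪_E`.
  obtain ⟨ι, hι⟩ := exists_ringHom_quadOrder (E := D)
    (⟨t.δ - m * k, m⟩ : QuadOrder E) (by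
      have h1 : 2 * (t.δ - m * k) + m * E = D := by rw [hDm, hk]; ring
      have h4 := four_dvd_sub_sq hdisc
      generalize t.δ - m * k = x at h1
      ext
      · simp only [QuadraticAlgebra.re_mul, QuadraticAlgebra.re_add, QuadraticAlgebra.re_smul,
          smul_eq_mul, QuadraticAlgebra.re_one, mul_one]
        have : 4 * (x * x + (E - E ^ 2) / 4 * m * m) = 4 * ((D - D ^ 2) / 4 + D * x) := by
          rw [mul_add 4 ((D - D ^ 2) / 4), h4]
          linear_combination m ^ 2 * hE4' - hDE - (D - 2 * x + m * E) * h1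
        linarith
      · simp only [QuadraticAlgebra.im_mul, QuadraticAlgebra.im_add, QuadraticAlgebra.im_smul,
          smul_eq_mul, QuadraticAlgebra.im_one, mul_zero, zero_add]
        linear_combination m * h1)
  have hcomp : ρ'.comp ι = X.ρ := by
    refine ringHom_quadOrder_ext ?_
    rw [RingHom.comp_apply, hι, ringHom_quadOrder_apply, hρ']
    apply Subtype.ext
    show ((t.δ - m * k : ℤ) : Module.End ℂ C2) + (m : Module.End ℂ C2) * (f + k • 1) = X.gamma
    have : X.gamma = m • f + t.δ • 1 := by rw [hmf]; module
    rw [this, mul_add, ← zsmul_eq_mul, ← zsmul_one]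
    simp only [← zsmul_eq_mul]
    module
  -- A preimage of the generator of `𝒪_E` exhibits an inverse of `m`.
  obtain ⟨x, hx⟩ := X.proper E hE4 ι ⟨ρ', hcomp⟩ (gammaD E)
  rw [ringHom_quadOrder_apply, hι] at hx
  have := congrArg QuadraticAlgebra.im hx
  simp [gammaD] at this
  exact IsUnit.of_mul_eq_one x.im (by linarith)

/-- An action through primitive data is proper. -/
theorem RMData.Primitive.isProperAction (hn : 0 < n) {T : PolarizedAbelianSurface n}
    {ρ : QuadOrder D →+* T.endRing} {t : RMData} (ht : t.Primitive) {l₁ l₂ m₁ m₂ : C2}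
    (hF : SymplecticFrame n T.lattice T.form l₁ l₂ m₁ m₂)
    (hA : ActsBy n (ρ (gammaD D) : Module.End ℂ C2) t l₁ l₂ m₁ m₂) : IsProperAction T ρ := by
  rintro E - ι ⟨ρ', rfl⟩
  obtain ⟨x, y, hxy⟩ : ∃ x y, ι (gammaD D) = ⟨x, y⟩ := ⟨_, _, (QuadraticAlgebra.mk_eta _).symm⟩
  have hg : ((ρ'.comp ι (gammaD D) : T.endRing) : Module.End ℂ C2) =
      x • 1 + y • (ρ' (gammaD E) : Module.End ℂ C2) := by
    rw [RingHom.comp_apply, hxy, ringHom_quadOrder_apply]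
    simp [zsmul_eq_mul]
  rw [hg] at hA
  have hmem := (ρ' (gammaD E)).2
  generalize ((ρ' (gammaD E) : T.endRing) : Module.End ℂ C2) = g at hA hmem
  have key : ∀ v ∈ T.lattice, ∃ p q r s : ℤ, (x • 1 + y • g : Module.End ℂ C2) v =
      x • v + (y * p) • l₁ + (y * q) • l₂ + (y * r) • m₁ + (y * s) • m₂ := by
    intro v hv
    obtain ⟨p, q, r, s, h⟩ := hF.span _ (hmem v hv)
    refine ⟨p, q, r, s, ?_⟩
    rw [LinearMap.add_apply, LinearMap.smul_apply, LinearMap.smul_apply, h, Module.End.one_apply]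
    module
  obtain ⟨p1, q1, r1, s1, h1⟩ := key _ hF.mem_l₁
  obtain ⟨p2, q2, r2, s2, h2⟩ := key _ hF.mem_l₂
  obtain ⟨p3, q3, r3, s3, h3⟩ := key _ hF.mem_m₁
  have k1 := hF.int_ext T.alternating hn (x := t.α) (y := t.c) (z := 0) (w := t.d)
    (x' := x + y * p1) (y' := y * q1) (z' := y * r1) (w' := y * s1)
    (by have := hA.map_l₁.symm.trans h1; rw [← sub_eq_zero] at this ⊢; rw [← this]; module)
  have k2 := hF.int_ext T.alternating hn (x := n * t.β) (y := t.δ) (z := -(n * t.d)) (w := 0)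
    (x' := y * p2) (y' := x + y * q2) (z' := y * r2) (w' := y * s2)
    (by have := hA.map_l₂.symm.trans h2; rw [← sub_eq_zero] at this ⊢; rw [← this]; module)
  have k3 := hF.int_ext T.alternating hn (x := 0) (y := t.e) (z := t.α) (w := t.β)
    (x' := y * p3) (y' := y * q3) (z' := x + y * r3) (w' := y * s3)
    (by have := hA.map_m₁.symm.trans h3; rw [← sub_eq_zero] at this ⊢; rw [← this]; module)
  have hy : IsUnit y := ht y ⟨_, k3.2.2.2⟩ ⟨_, k1.2.1⟩ ⟨_, k1.2.2.2⟩ ⟨_, k3.2.1⟩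
    ⟨p1 - q2, by rw [k1.1, k2.2.1]; ring⟩
  have hyy := Int.isUnit_mul_self hy
  intro w
  -- The unit `y` is its own inverse, so this solves `γ ↦ x + y γ_E` for the preimage of `w`.
  refine ⟨⟨w.re - x * y * w.im, y * w.im⟩, ?_⟩
  rw [ringHom_quadOrder_apply, hxy]
  ext
  · simp; ring
  · simp; linear_combination w.im * hyy

/-- `γ` acts as the scalar `a` for the form `E` modulo `n`. -/
def RMSurface.HasResidue (X : RMSurface n D) (a : ℤ) : Prop :=
  ∀ v ∈ X.lattice, ∀ w ∈ X.lattice, ∃ m : ℤ, X.form (X.gamma v) w - a * X.form v w = n * m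

theorem RMSurface.HasData.hasResidue_iff {X : RMSurface n D} {t : RMData} (h : X.HasData t)
    (a : ℤ) : X.HasResidue a ↔ (n : ℤ) ∣ t.α - a := by
  obtain ⟨l₁, l₂, m₁, m₂, hF, hA⟩ := h
  have hE := X.alternating
  constructor
  · intro h
    obtain ⟨m, hm⟩ := h l₁ hF.mem_l₁ m₁ hF.mem_m₁
    rw [hA.map_l₁] at hm
    simp only [map_add, LinearMap.add_apply, form_zsmul_left, hF.l₁_m₁, hF.l₂_m₁,
      form_swap hE m₁ m₂, hF.m₁_m₂] at hm
    refine ⟨m, ?_⟩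
    have : ((t.α - a : ℤ) : ℝ) = (n * m : ℤ) := by push_cast; linarith
    exact_mod_cast this
  · rintro ⟨k, hk⟩ v hv w hw
    obtain ⟨x, y, z, u, rfl⟩ := hF.span v hv
    obtain ⟨x', y', z', u', rfl⟩ := hF.span w hw
    -- Only `α` survives modulo `n`: the other entries either carry a factor `n` or are paired
    -- through `E(λ₂, μ₂) = n`.
    refine ⟨(x * k + y * t.β - u * t.e) * z' + (x * t.c + y * t.δ + z * t.e - a * y) * u' -
      (-(t.d * y) + z * k + t.c * u) * x' - (x * t.d + z * t.β + u * t.δ - a * u) * y', ?_⟩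
    have hα : (t.α : ℝ) = a + n * k := by
      have : t.α = a + n * k := by linarith
      rw [this]; push_cast; ring
    simp only [map_add, map_zsmul X.gamma, hA.map_l₁, hA.map_l₂, hA.map_m₁, hA.map_m₂,
      LinearMap.add_apply, form_zsmul_left, form_zsmul_right, hE, hF.l₁_l₂, hF.m₁_m₂, hF.l₁_m₁,
      hF.l₂_m₂, hF.l₁_m₂, hF.l₂_m₁, form_swap hE l₁ l₂, form_swap hE m₁ m₂, form_swap hE l₁ m₁,
      form_swap hE l₂ m₂, form_swap hE l₁ m₂, form_swap hE l₂ m₁]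
    push_cast
    rw [hα]
    ring

theorem RMSurface.Iso.hasResidue {X Y : RMSurface n D} (h : X.Iso Y) {a : ℤ}
    (hX : X.HasResidue a) : Y.HasResidue a := by
  obtain ⟨φ, h1, h2, h3⟩ := h
  intro v hv w hw
  rw [← φ.apply_symm_apply v] at hv ⊢
  rw [← φ.apply_symm_apply w] at hw ⊢
  rw [h1] at hv hw
  obtain ⟨m, hm⟩ := hX _ hv _ hw
  refine ⟨m, ?_⟩
  have := h3 (gammaD D) (φ.symm v)
  rw [← hm, ← h2, ← h2]
  unfold RMSurface.gamma
  rw [this]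

theorem RMSurface.frameStable_hasData (X : RMSurface n D) :
    FrameStable n X.HasData where
  change₂ := by
    rintro t ⟨l₁, l₂, m₁, m₂, hF, hA⟩ p q r s h
    obtain ⟨l₂', m₂', h'⟩ := hF.change₂ X.alternating hA h
    exact ⟨_, _, _, _, h'⟩
  change₁ := by
    rintro t ⟨l₁, l₂, m₁, m₂, hF, hA⟩ p q r s h
    obtain ⟨l₁', m₁', h'⟩ := hF.change₁ X.alternating hA h
    exact ⟨_, _, _, _, h'⟩
  shear₁ := by
    rintro t ⟨l₁, l₂, m₁, m₂, hF, hA⟩ k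
    obtain ⟨l₁', m₂', h'⟩ := hF.shear₁ X.alternating hA k
    exact ⟨_, _, _, _, h'⟩
  shear₂ := by
    rintro t ⟨l₁, l₂, m₁, m₂, hF, hA⟩ k
    obtain ⟨l₂', m₁', h'⟩ := hF.shear₂ X.alternating hA k
    exact ⟨_, _, _, _, h'⟩

theorem RMSurface.HasResidue.exists_normal (hn : 0 < n) (hdisc : D ≡ 0 [ZMOD 4] ∨ D ≡ 1 [ZMOD 4])
    (hsq : ¬ IsSquare D) {X : RMSurface n D} {a : ℤ} (h : X.HasResidue a) :
    ∃ t, X.HasData t ∧ t.d = 0 ∧ t.e = 0 ∧ t.c = 1 ∧ t.α = a := by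
  obtain ⟨t, ht⟩ := X.exists_hasData hn
  exact X.frameStable_hasData.exists_normal (fun t ht => by rwa [ht.disc hdisc])
    (fun t ht => ht.primitive hdisc) (fun t ht => (ht.hasResidue_iff a).1 h) ht

/-! ### Period matrices of surfaces with real multiplication -/

/-- The integral matrix described by the data. -/
def RMData.mat (n : ℕ) (t : RMData) : Matrix (Fin 2 ⊕ Fin 2) (Fin 2 ⊕ Fin 2) ℤ :=
  Matrix.fromBlocks !![t.α, n * t.β; t.c, t.δ] !![0, -(n * t.e); t.e, 0]
    !![0, -(n * t.d); t.d, 0] !![t.α, n * t.c; t.β, t.δ]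

theorem actsBy_iff_mat {Λ : Submodule ℤ C2} (b : Module.Basis (Fin 2 ⊕ Fin 2) ℤ Λ)
    {f : Module.End ℂ C2} {t : RMData} :
    ActsBy n f t (b (Sum.inl 0)) (b (Sum.inl 1)) (b (Sum.inr 0)) (b (Sum.inr 1)) ↔
    ∀ j, f (b j) = ∑ i, t.mat n i j • (b i : C2) := by
  constructor
  · intro h
    rintro (j | j) <;> fin_cases j <;>
      simp only [Fintype.sum_sum_type, Fin.sum_univ_two, RMData.mat, Matrix.fromBlocks_apply₁₁,
        Matrix.fromBlocks_apply₁₂, Matrix.fromBlocks_apply₂₁, Matrix.fromBlocks_apply₂₂,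
        Fin.zero_eta, Fin.mk_one, Matrix.of_apply, Matrix.cons_val', Matrix.cons_val_zero,
        Matrix.cons_val_one, Matrix.cons_val_fin_one]
    · rw [h.map_l₁]; module
    · rw [h.map_l₂]; module
    · rw [h.map_m₁]; module
    · rw [h.map_m₂]; module
  · intro h
    constructor
    all_goals
      rw [h]
      simp only [Fintype.sum_sum_type, Fin.sum_univ_two, RMData.mat, Matrix.fromBlocks_apply₁₁,
        Matrix.fromBlocks_apply₁₂, Matrix.fromBlocks_apply₂₁, Matrix.fromBlocks_apply₂₂,
        Fin.zero_eta, Fin.mk_one, Matrix.of_apply, Matrix.cons_val', Matrix.cons_val_zero,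
        Matrix.cons_val_one, Matrix.cons_val_fin_one]
      module

/-- The vectors `l₁, l₂, m₁, m₂` have the period matrix given by `z` in the coordinates `φ`. -/
structure HasPeriods (n : ℕ) (φ : C2 ≃ₗ[ℂ] C2) (z : Fin 3 → ℂ) (l₁ l₂ m₁ m₂ : C2) : Prop where
  map_l₁ : φ l₁ = ![z 0, z 1]
  map_l₂ : φ l₂ = ![z 1, z 2]
  map_m₁ : φ m₁ = ![1, 0]
  map_m₂ : φ m₂ = ![0, (n : ℂ)]

theorem isPeriod_mat_iff (hn : 0 < n) {X : RMSurface n D} {z : Fin 3 → ℂ} {t : RMData} :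
    IsPeriod X z (t.mat n) ↔ ∃ l₁ l₂ m₁ m₂ φ, SymplecticFrame n X.lattice X.form l₁ l₂ m₁ m₂ ∧
      ActsBy n X.gamma t l₁ l₂ m₁ m₂ ∧ HasPeriods n φ z l₁ l₂ m₁ m₂ := by
  constructor
  · rintro ⟨b, φ, hb, h1, h2, h3⟩
    refine ⟨_, _, _, _, φ, hb.frame, (actsBy_iff_mat b).2 h3, ?_, ?_, ?_, ?_⟩
    · ext i; rw [h1]; fin_cases i <;> simp [symMatrix]
    · ext i; rw [h1]; fin_cases i <;> simp [symMatrix]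
    · ext i; rw [h2]; fin_cases i <;> simp [polType]
    · ext i; rw [h2]; fin_cases i <;> simp [polType]
  · rintro ⟨l₁, l₂, m₁, m₂, φ, hF, hA, hφ⟩
    obtain ⟨b, hb, rfl, rfl, rfl, rfl⟩ := hF.exists_basis X.alternating hn
    refine ⟨b, φ, hb, ?_, ?_, (actsBy_iff_mat b).1 hA⟩
    · intro j i
      fin_cases j
      · show φ (b (Sum.inl 0)) i = _
        rw [hφ.map_l₁]; fin_cases i <;> simp [symMatrix]
      · show φ (b (Sum.inl 1)) i = _
        rw [hφ.map_l₂]; fin_cases i <;> simp [symMatrix]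
    · intro j i
      fin_cases j
      · show φ (b (Sum.inr 0)) i = _
        rw [hφ.map_m₁]; fin_cases i <;> simp [polType]
      · show φ (b (Sum.inr 1)) i = _
        rw [hφ.map_m₂]; fin_cases i <;> simp [polType]

/-- Self-adjointness restricts the matrices `R` that occur, so analyticity need only be examined for
matrices coming from data. -/
theorem IsPeriod.exists_data (hn : 0 < n) {X : RMSurface n D} {z : Fin 3 → ℂ}
    {R : Matrix (Fin 2 ⊕ Fin 2) (Fin 2 ⊕ Fin 2) ℤ} (h : IsPeriod X z R) :
    ∃ t, R = t.mat n ∧ X.HasData t := by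
  obtain ⟨b, φ, hb, h1, h2, h3⟩ := h
  obtain ⟨t, ht⟩ := hb.frame.exists_actsBy X.alternating hn (fun _ => X.gamma_mem)
    (X.selfAdjoint (gammaD D))
  refine ⟨t, ?_, _, _, _, _, hb.frame, ht⟩
  ext i j
  have h4 := (h3 j).symm.trans ((actsBy_iff_mat b).1 ht j)
  have h5 : ∑ i, R i j • b i = ∑ i, t.mat n i j • b i := by
    apply Subtype.ext
    simpa only [Submodule.coe_sum, Submodule.coe_smul] using h4
  have h6 := congrArg (fun v => b.repr v i) h5
  simpa only [b.repr_sum_self] using h6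

/-- Matching the two period frames is `ℂ`-linear because their coordinates agree. It respects
lattice and form because both frames are symplectic, and the action because `γ` has the same matrix
in both. -/
theorem IsPeriod.iso (hn : 0 < n) {X Y : RMSurface n D} {z : Fin 3 → ℂ}
    {R : Matrix (Fin 2 ⊕ Fin 2) (Fin 2 ⊕ Fin 2) ℤ} (hX : IsPeriod X z R) (hY : IsPeriod Y z R) :
    X.Iso Y := by
  obtain ⟨t, rfl, -⟩ := hX.exists_data hn
  obtain ⟨l₁, l₂, m₁, m₂, φ, hF, hA, hφ⟩ := (isPeriod_mat_iff hn).1 hX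
  obtain ⟨l₁', l₂', m₁', m₂', ψ, hF', hA', hψ⟩ := (isPeriod_mat_iff hn).1 hY
  let χ : C2 ≃ₗ[ℂ] C2 := φ.trans ψ.symm
  have e1 : χ l₁ = l₁' := by
    rw [LinearEquiv.trans_apply, LinearEquiv.symm_apply_eq, hφ.map_l₁, hψ.map_l₁]
  have e2 : χ l₂ = l₂' := by
    rw [LinearEquiv.trans_apply, LinearEquiv.symm_apply_eq, hφ.map_l₂, hψ.map_l₂]
  have e3 : χ m₁ = m₁' := by
    rw [LinearEquiv.trans_apply, LinearEquiv.symm_apply_eq, hφ.map_m₁, hψ.map_m₁]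
  have e4 : χ m₂ = m₂' := by
    rw [LinearEquiv.trans_apply, LinearEquiv.symm_apply_eq, hφ.map_m₂, hψ.map_m₂]
  clear_value χ
  subst e1 e2 e3 e4
  have hγ : χ.toLinearMap * X.gamma = Y.gamma * χ.toLinearMap := by
    have : (χ.toLinearMap * X.gamma).restrictScalars ℝ =
        (Y.gamma * χ.toLinearMap).restrictScalars ℝ := by
      refine hF.ext_real X.span_eq_top ?_ ?_ ?_ ?_
      · simpa [-zsmul_eq_mul, hA.map_l₁] using hA'.map_l₁.symm
      · simpa [-zsmul_eq_mul, hA.map_l₂] using hA'.map_l₂.symm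
      · simpa [-zsmul_eq_mul, hA.map_m₁] using hA'.map_m₁.symm
      · simpa [-zsmul_eq_mul, hA.map_m₂] using hA'.map_m₂.symm
    exact LinearMap.ext fun v => LinearMap.congr_fun this v
  refine ⟨χ, fun v => ⟨fun hv => ?_, fun hv => ?_⟩, ?_, fun a v => ?_⟩
  · obtain ⟨x, y, z, w, h⟩ := hF'.span _ hv
    have : v = x • l₁ + y • l₂ + z • m₁ + w • m₂ := by
      apply χ.injective
      rw [h]; simp only [map_add, map_zsmul]
    rw [this]
    exact add_mem (add_mem (add_mem (Submodule.smul_mem _ _ hF.mem_l₁)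
      (Submodule.smul_mem _ _ hF.mem_l₂)) (Submodule.smul_mem _ _ hF.mem_m₁))
      (Submodule.smul_mem _ _ hF.mem_m₂)
  · obtain ⟨x, y, z, w, rfl⟩ := hF.span _ hv
    simp only [map_add, map_zsmul]
    exact add_mem (add_mem (add_mem (Submodule.smul_mem _ _ hF'.mem_l₁)
      (Submodule.smul_mem _ _ hF'.mem_l₂)) (Submodule.smul_mem _ _ hF'.mem_m₁))
      (Submodule.smul_mem _ _ hF'.mem_m₂)
  · have hE := X.alternating
    have hE' := Y.alternating
    have : Y.form.compl₁₂ (χ.toLinearMap.restrictScalars ℝ) (χ.toLinearMap.restrictScalars ℝ) =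
        X.form := by
      refine hF.ext_real X.span_eq_top ?_ ?_ ?_ ?_ <;>
      refine hF.ext_real X.span_eq_top ?_ ?_ ?_ ?_ <;>
      simp [hE, hE', hF.l₁_l₂, hF.m₁_m₂, hF.l₁_m₁, hF.l₂_m₂, hF.l₁_m₂, hF.l₂_m₁,
        form_swap hE l₁ l₂, form_swap hE m₁ m₂, form_swap hE l₁ m₁, form_swap hE l₂ m₂,
        form_swap hE l₁ m₂, form_swap hE l₂ m₁,
        hF'.l₁_l₂, hF'.m₁_m₂, hF'.l₁_m₁, hF'.l₂_m₂, hF'.l₁_m₂, hF'.l₂_m₁,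
        form_swap hE' (χ l₁) (χ l₂), form_swap hE' (χ m₁) (χ m₂), form_swap hE' (χ l₁) (χ m₁),
        form_swap hE' (χ l₂) (χ m₂), form_swap hE' (χ l₁) (χ m₂), form_swap hE' (χ l₂) (χ m₁)]
    intro v w
    exact LinearMap.congr_fun (LinearMap.congr_fun this v) w
  · have := LinearMap.congr_fun hγ v
    simp only [Module.End.mul_apply, LinearEquiv.coe_coe] at this
    rw [X.rho_coe, Y.rho_coe]
    simp only [← zsmul_eq_mul, ← zsmul_one, smul_mul_assoc, one_mul, LinearMap.add_apply,
      LinearMap.smul_apply,      Module.End.one_apply, map_add, map_zsmul, this]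

theorem mem_siegelSpace_iff {z : Fin 3 → ℂ} : z ∈ siegelSpace ↔
    0 < (z 0).im ∧ (z 1).im ^ 2 < (z 0).im * (z 2).im := by
  have key : z ∈ siegelSpace ↔ ∀ x : Fin 2 → ℝ, x ≠ 0 →
      0 < (z 0).im * x 0 ^ 2 + 2 * (z 1).im * x 0 * x 1 + (z 2).im * x 1 ^ 2 := by
    have hH : ((symMatrix z).map Complex.im).IsHermitian := by
      ext i j
      fin_cases i <;> fin_cases j <;> simp [symMatrix]
    have hq (x : Fin 2 → ℝ) : star x ⬝ᵥ ((symMatrix z).map Complex.im).mulVec x =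
        (z 0).im * x 0 ^ 2 + 2 * (z 1).im * x 0 * x 1 + (z 2).im * x 1 ^ 2 := by
      simp [symMatrix, Matrix.mulVec, dotProduct, Fin.sum_univ_two]
      ring
    show ((symMatrix z).map Complex.im).PosDef ↔ _
    rw [Matrix.posDef_iff_dotProduct_mulVec]
    simp only [hH, hq, true_and]
  rw [key]
  constructor
  · intro h
    have h0 : 0 < (z 0).im := by
      have := h ![1, 0] (by simp)
      simpa using this
    refine ⟨h0, ?_⟩
    -- At this vector the quadratic form equals `Im z₁` times the determinant of the imaginary part.
    have := h ![(z 1).im, -(z 0).im] (fun h => by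
      have := congrFun h 1
      simp at this
      exact h0.ne' this)
    simp at this
    have h2 : 0 < (z 0).im * ((z 0).im * (z 2).im - (z 1).im ^ 2) := by linarith
    linarith [(mul_pos_iff_of_pos_left h0).1 h2]
  · rintro ⟨h0, h1⟩ x hx
    have e : (z 0).im * ((z 0).im * x 0 ^ 2 + 2 * (z 1).im * x 0 * x 1 + (z 2).im * x 1 ^ 2) =
      ((z 0).im * x 0 + (z 1).im * x 1) ^ 2 + ((z 0).im * (z 2).im - (z 1).im ^ 2) * x 1 ^ 2 := by
      ring
    have hΔ : 0 < (z 0).im * (z 2).im - (z 1).im ^ 2 := by linarith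
    refine (mul_pos_iff_of_pos_left h0).1 ?_
    rw [e]
    by_cases hx1 : x 1 = 0
    · have hx0 : x 0 ≠ 0 := by
        intro h; apply hx; ext i; fin_cases i <;> simpa
      rw [hx1]
      have := sq_pos_of_ne_zero (mul_ne_zero h0.ne' hx0)
      linarith
    · positivity

/-- The polynomial whose zeros in `ℍ₂` are the periods of surfaces with the given data. -/
def RMData.relation (n : ℕ) (t : RMData) (z : Fin 3 → ℂ) : ℂ :=
  t.e * (z 0 * z 2 - z 1 ^ 2) + n * t.β * z 0 + (t.δ - t.α) * z 1 - t.c * z 2 - n * t.d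

/-- The frame is linearly dependent over `ℂ`: `l₁ = z₁ m₁ + (z₂ / n) m₂`. Applying `f` to this and
comparing the second coordinates gives the relation. -/
theorem HasPeriods.relation_eq_zero (hn : 0 < n) {t : RMData} {f : Module.End ℂ C2}
    {φ : C2 ≃ₗ[ℂ] C2} {z : Fin 3 → ℂ} {l₁ l₂ m₁ m₂ : C2} (hA : ActsBy n f t l₁ l₂ m₁ m₂)
    (hφ : HasPeriods n φ z l₁ l₂ m₁ m₂) : t.relation n z = 0 := by
  have hn' : (n : ℂ) ≠ 0 := by exact_mod_cast hn.ne'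
  have h1 : l₁ = z 0 • m₁ + (z 1 / n) • m₂ := by
    apply φ.injective
    rw [map_add, map_smul, map_smul, hφ.map_l₁, hφ.map_m₁, hφ.map_m₂]
    ext i; fin_cases i <;> simp [hn']
  have h2 := hA.map_l₁
  nth_rw 1 [h1] at h2
  rw [map_add, map_smul, map_smul, hA.map_m₁, hA.map_m₂] at h2
  have h3 := congrFun (congrArg φ h2) 1
  simp only [map_add, map_smul, map_zsmul, hφ.map_l₁, hφ.map_l₂, hφ.map_m₁, hφ.map_m₂] at h3
  simp [hn'] at h3
  field_simp at h3
  unfold RMData.relation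
  linear_combination h3

/-- Riemann's relations: a symplectic frame of a polarized abelian surface has a period matrix
in Siegel's upper half space. -/
theorem SymplecticFrame.exists_hasPeriods (hn : 0 < n) (T : PolarizedAbelianSurface n)
    {l₁ l₂ m₁ m₂ : C2} (hF : SymplecticFrame n T.lattice T.form l₁ l₂ m₁ m₂) :
    ∃ z ∈ siegelSpace, ∃ φ, HasPeriods n φ z l₁ l₂ m₁ m₂ := by
  have hn' : (n : ℝ) ≠ 0 := by exact_mod_cast hn.ne'
  have hE := T.alternating
  obtain ⟨e, he⟩ : ∃ e, e = (n : ℝ)⁻¹ • m₂ := ⟨_, rfl⟩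
  have hne : (n : ℂ) • e = m₂ := by
    rw [he, show (n : ℂ) = ((n : ℝ) : ℂ) by simp, Complex.coe_smul, smul_smul,
      mul_inv_cancel₀ hn', one_smul]
  have hme : T.form m₁ e = 0 := by rw [he, map_smul, hF.m₁_m₂, smul_zero]
  have hl₁e : T.form l₁ e = 0 := by rw [he, map_smul, hF.l₁_m₂, smul_zero]
  have hl₂e : T.form l₂ e = 1 := by
    rw [he, map_smul, hF.l₂_m₂, smul_eq_mul, inv_mul_cancel₀ hn']
  have hem : T.form e m₁ = 0 := by rw [form_swap hE, hme, neg_zero]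
  have hindep : ∀ a b : ℝ, a • m₁ + b • e = 0 → a = 0 ∧ b = 0 := by
    intro a b h
    have := hF.eq_zero hE hn (x := 0) (y := 0) (z := a) (w := b * (n : ℝ)⁻¹)
      (by rw [← h, he]; module)
    refine ⟨this.2.2.1, ?_⟩
    simpa [hn'] using this.2.2.2
  have hexp : ∀ a b : ℂ, a • m₁ + b • e = (a.re • m₁ + b.re • e) +
      Complex.I • (a.im • m₁ + b.im • e) := by
    intro a b
    conv_lhs => rw [← Complex.re_add_im a, ← Complex.re_add_im b]
    simp only [← Complex.coe_smul (E := C2)]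
    module
  -- The real span of `m₁` and `e = m₂ / n` is isotropic, so positivity makes these two vectors
  -- independent over `ℂ`; they supply the coordinates `φ`.
  have hpos : ∀ a b : ℝ, a ≠ 0 ∨ b ≠ 0 → 0 < T.form (Complex.I • (a • m₁ + b • e)) (a • m₁ + b • e) := by
    intro a b hab
    refine T.form_pos _ fun h => ?_
    have := hindep a b h
    tauto
  let g : C2 →ₗ[ℂ] C2 := (LinearMap.proj 0).smulRight m₁ + (LinearMap.proj 1).smulRight e
  have hg : ∀ v, g v = v 0 • m₁ + v 1 • e := fun v => rfl
  have hginj : Function.Injective g := by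
    rw [injective_iff_map_eq_zero]
    intro v hv
    rw [hg, hexp] at hv
    have h0 : (v 0).im = 0 ∧ (v 1).im = 0 := by
      by_contra h
      have := hpos (v 0).im (v 1).im (by tauto)
      rw [← add_eq_zero_iff_neg_eq.1 hv] at this
      simp [-Complex.real_smul, hE, hme, hem] at this
    rw [h0.1, h0.2, zero_smul, zero_smul, add_zero, smul_zero, add_zero] at hv
    have h1 := hindep _ _ hv
    ext i
    fin_cases i
    · exact Complex.ext h1.1 h0.1
    · exact Complex.ext h1.2 h0.2
  let φ : C2 ≃ₗ[ℂ] C2 := (LinearEquiv.ofInjectiveEndo g hginj).symm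
  have hφ : ∀ v w, g v = w → φ w = v := by
    rintro v w rfl
    exact (LinearEquiv.symm_apply_eq _).2 rfl
  have hφ' : ∀ v, v = φ v 0 • m₁ + φ v 1 • e := by
    intro v
    have : g (φ v) = v := (LinearEquiv.ofInjectiveEndo g hginj).apply_symm_apply v
    rw [← hg, this]
  -- `S1, S2, S3` are the entries of the Gram matrix of `E(iv, w)` on `m₁, e`. The imaginary part of
  -- the period matrix turns out to be its inverse, hence positive definite.
  obtain ⟨S1, hS1⟩ : ∃ S, S = T.form (Complex.I • m₁) m₁ := ⟨_, rfl⟩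
  obtain ⟨S2, hS2⟩ : ∃ S, S = T.form (Complex.I • m₁) e := ⟨_, rfl⟩
  obtain ⟨S3, hS3⟩ : ∃ S, S = T.form (Complex.I • e) e := ⟨_, rfl⟩
  have hS2' : T.form (Complex.I • e) m₁ = S2 := by
    rw [hS2, ← T.form_I_I (Complex.I • m₁) e, form_swap hE (Complex.I • e), smul_smul,
      Complex.I_mul_I, neg_one_smul, map_neg, neg_neg]
  have hIS1 : T.form m₁ (Complex.I • m₁) = -S1 := by rw [form_swap hE, hS1]
  have hIS2 : T.form e (Complex.I • m₁) = -S2 := by rw [form_swap hE, hS2]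
  have hIS2' : T.form m₁ (Complex.I • e) = -S2 := by rw [form_swap hE, hS2']
  have hIS3 : T.form e (Complex.I • e) = -S3 := by rw [form_swap hE, hS3]
  have hII : T.form (Complex.I • m₁) (Complex.I • e) = 0 := by rw [T.form_I_I, hme]
  have hII' : T.form (Complex.I • e) (Complex.I • m₁) = 0 := by rw [T.form_I_I, hem]
  have hform : ∀ a b c d : ℂ, T.form (a • m₁ + b • e) (c • m₁ + d • e) =
      a.im * c.re * S1 + (a.im * d.re + b.im * c.re) * S2 + b.im * d.re * S3 -
      (a.re * c.im * S1 + (a.re * d.im + b.re * c.im) * S2 + b.re * d.im * S3) := by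
    intro a b c d
    rw [hexp, hexp]
    simp only [smul_add, smul_comm Complex.I (_ : ℝ) (_ : C2), map_add, map_smul,
      LinearMap.add_apply, LinearMap.smul_apply, hE, hme, hem, hS2', ← hS1, ← hS2, ← hS3, hIS1,
      hIS2, hIS2', hIS3, hII, hII', smul_eq_mul]
    ring
  have hquad : ∀ a b : ℝ, a ≠ 0 ∨ b ≠ 0 → 0 < a ^ 2 * S1 + 2 * a * b * S2 + b ^ 2 * S3 := by
    intro a b hab
    have := hpos a b hab
    simp only [smul_add, smul_comm Complex.I (_ : ℝ) (_ : C2), map_add, map_smul,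
      LinearMap.add_apply, LinearMap.smul_apply, hS2', ← hS1, ← hS2, ← hS3, smul_eq_mul] at this
    linarith
  have hS1pos : 0 < S1 := by simpa using hquad 1 0 (by simp)
  have hΔ : 0 < S1 * S3 - S2 ^ 2 := by
    have := hquad S2 (-S1) (Or.inr (by linarith))
    have h2 : 0 < S1 * (S1 * S3 - S2 ^ 2) := by linarith
    exact (mul_pos_iff_of_pos_left hS1pos).1 h2
  have hφl₁ := hφ' l₁
  have hφl₂ := hφ' l₂
  generalize hw : φ l₁ 0 = a at hφl₁
  generalize hx : φ l₁ 1 = b at hφl₁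
  generalize hy : φ l₂ 0 = c at hφl₂
  generalize hz : φ l₂ 1 = d at hφl₂
  have k1 := hform a b 1 0
  have k2 := hform a b 0 1
  have k3 := hform c d 1 0
  have k4 := hform c d 0 1
  have k5 := hform a b c d
  rw [← hφl₁, one_smul, zero_smul, add_zero, hF.l₁_m₁] at k1
  rw [← hφl₁, one_smul, zero_smul, zero_add, hl₁e] at k2
  rw [← hφl₂, one_smul, zero_smul, add_zero, hF.l₂_m₁] at k3
  rw [← hφl₂, one_smul, zero_smul, zero_add, hl₂e] at k4
  rw [← hφl₁, ← hφl₂, hF.l₁_l₂] at k5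
  simp only [Complex.one_re, Complex.one_im, Complex.zero_re, Complex.zero_im, mul_zero, zero_mul,
    add_zero, zero_add, mul_one, sub_zero] at k1 k2 k3 k4
  have hS3pos : 0 < S3 := by simpa using hquad 0 1 (by simp)
  have ha : a.im * (S1 * S3 - S2 ^ 2) = S3 := by linear_combination S2 * k2 - S3 * k1
  have hb : b.im * (S1 * S3 - S2 ^ 2) = -S2 := by linear_combination S2 * k1 - S1 * k2
  have hc : c.im * (S1 * S3 - S2 ^ 2) = -S2 := by linear_combination S2 * k4 - S3 * k3
  have hd : d.im * (S1 * S3 - S2 ^ 2) = S1 := by linear_combination S2 * k3 - S1 * k4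
  have him : b.im = c.im := mul_right_cancel₀ hΔ.ne' (hb.trans hc.symm)
  -- The symmetry of the real part is the relation `E(l₁, l₂) = 0`.
  have hre : b.re = c.re := by
    linear_combination (-c.re) * k1 - d.re * k2 + a.re * k3 + b.re * k4 + k5
  have hbc : b = c := Complex.ext hre him
  refine ⟨![a, b, d], mem_siegelSpace_iff.2 ⟨?_, ?_⟩, φ, ?_, ?_, ?_, ?_⟩
  · show 0 < a.im
    exact (mul_pos_iff_of_pos_right hΔ).1 (ha.symm ▸ hS3pos)
  · show b.im ^ 2 < a.im * d.im
    refine lt_of_mul_lt_mul_right ?_ (sq_nonneg (S1 * S3 - S2 ^ 2))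
    calc b.im ^ 2 * (S1 * S3 - S2 ^ 2) ^ 2 = (b.im * (S1 * S3 - S2 ^ 2)) ^ 2 := by ring
      _ < (a.im * (S1 * S3 - S2 ^ 2)) * (d.im * (S1 * S3 - S2 ^ 2)) := by
        rw [ha, hb, hd]; linarith
      _ = _ := by ring
  · ext i; fin_cases i <;> simpa
  · ext i; fin_cases i <;> simpa [hbc]
  · refine hφ _ _ ?_
    simp [hg]
  · refine hφ _ _ ?_
    simp [hg, ← hne]

/-! ### Construction of surfaces from points of Siegel's upper half space -/

/-- Vectors with symplectic Gram matrix generate a lattice for which they form a frame. -/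
theorem exists_lattice {E : LinearMap.BilinForm ℝ C2} (hE : ∀ v, E v v = 0) (hn : 0 < n)
    {l₁ l₂ m₁ m₂ : C2} (h1 : E l₁ l₂ = 0) (h2 : E m₁ m₂ = 0) (h3 : E l₁ m₁ = 1)
    (h4 : E l₂ m₂ = n) (h5 : E l₁ m₂ = 0) (h6 : E l₂ m₁ = 0) :
    ∃ Λ : Submodule ℤ C2, DiscreteTopology Λ ∧ Submodule.span ℝ (Λ : Set C2) = ⊤ ∧
      SymplecticFrame n Λ E l₁ l₂ m₁ m₂ := by
  let v : Fin 4 → C2 := ![l₁, l₂, m₁, m₂]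
  have hF : SymplecticFrame n (Submodule.span ℤ (Set.range v)) E l₁ l₂ m₁ m₂ := by
    refine ⟨Submodule.subset_span ⟨0, rfl⟩, Submodule.subset_span ⟨1, rfl⟩,
      Submodule.subset_span ⟨2, rfl⟩, Submodule.subset_span ⟨3, rfl⟩, h1, h2, h3, h4, h5, h6, ?_⟩
    intro u hu
    obtain ⟨c, rfl⟩ := (Submodule.mem_span_range_iff_exists_fun ℤ).1 hu
    exact ⟨c 0, c 1, c 2, c 3, by rw [Fin.sum_univ_four]; rfl⟩
  have hli : LinearIndependent ℝ v := by
    rw [Fintype.linearIndependent_iff]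
    intro g hg
    rw [Fin.sum_univ_four] at hg
    obtain ⟨k1, k2, k3, k4⟩ := hF.eq_zero hE hn hg
    intro i
    fin_cases i <;> assumption
  have hcard : Fintype.card (Fin 4) = Module.finrank ℝ C2 := by
    rw [← Module.finrank_mul_finrank ℝ ℂ C2, Complex.finrank_real_complex]
    simp
  let b := basisOfLinearIndependentOfCardEqFinrank hli hcard
  have hb : ⇑b = v := coe_basisOfLinearIndependentOfCardEqFinrank hli hcard
  refine ⟨Submodule.span ℤ (Set.range v), ?_, ?_, hF⟩
  · rw [← hb]; infer_instance
  · rw [← hb]; exact ZSpan.span_top b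

/-- The symmetric real bilinear form with Gram matrix the inverse of `Im Z`. -/
def invIm (z : Fin 3 → ℂ) (x y : Fin 2 → ℝ) : ℝ :=
  ((z 2).im * x 0 * y 0 - (z 1).im * (x 0 * y 1 + x 1 * y 0) + (z 0).im * x 1 * y 1) /
    ((z 0).im * (z 2).im - (z 1).im ^ 2)

/-- The Riemann form of the abelian surface with period matrix given by `z`. -/
def riemannForm (z : Fin 3 → ℂ) : LinearMap.BilinForm ℝ C2 :=
  LinearMap.mk₂ ℝ (fun v w => invIm z (fun i => (v i).im) (fun i => (w i).re) -
      invIm z (fun i => (v i).re) (fun i => (w i).im))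
    (by intros; simp [invIm]; ring) (by intros; simp [invIm]; ring)
    (by intros; simp [invIm]; ring) (by intros; simp [invIm]; ring)

theorem riemannForm_apply (z : Fin 3 → ℂ) (v w : C2) : riemannForm z v w =
    invIm z (fun i => (v i).im) (fun i => (w i).re) -
      invIm z (fun i => (v i).re) (fun i => (w i).im) := rfl

/-- Each point of Siegel's upper half space is the period of a polarized abelian surface. -/
theorem exists_surface (hn : 0 < n) {z : Fin 3 → ℂ} (hz : z ∈ siegelSpace) :
    ∃ T : PolarizedAbelianSurface n, SymplecticFrame n T.lattice T.form ![z 0, z 1] ![z 1, z 2]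
      ![1, 0] ![0, (n : ℂ)] := by
  obtain ⟨h0, h1⟩ := mem_siegelSpace_iff.1 hz
  have hΔ : 0 < (z 0).im * (z 2).im - (z 1).im ^ 2 := by linarith
  have hE : ∀ v, riemannForm z v v = 0 := by
    intro v
    rw [riemannForm_apply]; unfold invIm; ring
  obtain ⟨Λ, hd, ht, hF⟩ := exists_lattice (E := riemannForm z) hE hn (l₁ := ![z 0, z 1])
    (l₂ := ![z 1, z 2]) (m₁ := ![1, 0]) (m₂ := ![0, (n : ℂ)])
    (by simp [riemannForm_apply, invIm]; ring)
    (by simp [riemannForm_apply, invIm])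
    (by simp [riemannForm_apply, invIm]; rw [div_eq_one_iff_eq hΔ.ne']; ring)
    (by simp [riemannForm_apply, invIm]; rw [div_eq_iff hΔ.ne']; ring)
    (by simp [riemannForm_apply, invIm]; left; ring)
    (by simp [riemannForm_apply, invIm]; left; ring)
  obtain ⟨b, hb, -⟩ := hF.exists_basis hE hn
  refine ⟨⟨Λ, hd, ht, riemannForm z, hE, ?_, ?_, ?_, b, hb⟩, hF⟩
  · intro v hv w hw
    obtain ⟨x, y, p, q, rfl⟩ := hF.span v hv
    obtain ⟨x', y', p', q', rfl⟩ := hF.span w hw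
    refine ⟨x * p' + n * (y * q') - p * x' - n * (q * y'), ?_⟩
    simp only [map_add, LinearMap.add_apply, form_zsmul_left, form_zsmul_right, hE, hF.l₁_l₂,
      hF.m₁_m₂, hF.l₁_m₁, hF.l₂_m₂, hF.l₁_m₂, hF.l₂_m₁, form_swap hE ![z 0, z 1] _,
      form_swap hE ![z 1, z 2] ![1, 0], form_swap hE ![z 1, z 2] ![0, (n : ℂ)],
      form_swap hE ![1, 0] ![0, (n : ℂ)]]
    push_cast
    ring
  · intro v w
    simp only [riemannForm_apply, Pi.smul_apply, smul_eq_mul, Complex.mul_re, Complex.mul_im,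
      Complex.I_re, Complex.I_im, zero_mul, one_mul, zero_sub, zero_add]
    unfold invIm; ring
  · intro v hv
    simp only [riemannForm_apply, Pi.smul_apply, smul_eq_mul, Complex.mul_re, Complex.mul_im,
      Complex.I_re, Complex.I_im, zero_mul, one_mul, zero_sub, zero_add, add_zero]
    -- Completing the square shows that the inverse of `Im Z` is positive definite.
    have hq : ∀ x : Fin 2 → ℝ, (z 0).im * ((z 0).im * (z 2).im - (z 1).im ^ 2) * invIm z x x =
        ((z 0).im * x 1 - (z 1).im * x 0) ^ 2 +
          ((z 0).im * (z 2).im - (z 1).im ^ 2) * x 0 ^ 2 := by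
      intro x; unfold invIm; field_simp; ring
    have hpos : 0 < (z 0).im * ((z 0).im * (z 2).im - (z 1).im ^ 2) := mul_pos h0 hΔ
    have hge : ∀ x : Fin 2 → ℝ, 0 ≤ invIm z x x := fun x => by
      refine nonneg_of_mul_nonneg_right ?_ hpos
      rw [hq]; positivity
    have hgt : ∀ x : Fin 2 → ℝ, invIm z x x = 0 → x 0 = 0 ∧ x 1 = 0 := fun x hx => by
      have h := hq x
      rw [hx, mul_zero] at h
      have h2 : x 0 = 0 := by
        by_contra h2
        have : 0 < ((z 0).im * (z 2).im - (z 1).im ^ 2) * x 0 ^ 2 := by positivity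
        linarith [sq_nonneg ((z 0).im * x 1 - (z 1).im * x 0)]
      rw [h2] at h
      refine ⟨h2, ?_⟩
      have h3 : ((z 0).im * x 1) ^ 2 = 0 := by linarith
      simpa [h0.ne'] using h3
    have e : invIm z (fun i => -(v i).im) (fun i => (v i).im) =
      -invIm z (fun i => (v i).im) (fun i => (v i).im) := by unfold invIm; ring
    rw [e, sub_neg_eq_add]
    have hre := hge fun i => (v i).re
    have him := hge fun i => (v i).im
    by_contra hle
    have hre0 := hgt (fun i => (v i).re) (by linarith)
    have him0 := hgt (fun i => (v i).im) (by linarith)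
    apply hv
    ext i
    fin_cases i
    · exact Complex.ext hre0.1 him0.1
    · exact Complex.ext hre0.2 him0.2

/-- The data of a surface with real multiplication by the order of discriminant `D`. -/
structure RMData.IsAdmissible (n : ℕ) (D : ℤ) (t : RMData) : Prop where
  tr : t.tr = D
  nm : t.nm n = -((D - D ^ 2) / 4)
  primitive : t.Primitive

theorem RMSurface.HasData.isAdmissible (hdisc : D ≡ 0 [ZMOD 4] ∨ D ≡ 1 [ZMOD 4])
    {X : RMSurface n D} {t : RMData} (h : X.HasData t) : t.IsAdmissible n D :=
  ⟨h.tr_nm.1, h.tr_nm.2, h.primitive hdisc⟩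

/-- A complex-linear action on the frame through admissible data is a real multiplication. -/
theorem SymplecticFrame.exists_rmSurface (hn : 0 < n) {T : PolarizedAbelianSurface n}
    {l₁ l₂ m₁ m₂ : C2} (hF : SymplecticFrame n T.lattice T.form l₁ l₂ m₁ m₂)
    {f : Module.End ℂ C2} {t : RMData} (ht : t.IsAdmissible n D)
    (hA : ActsBy n f t l₁ l₂ m₁ m₂) :
    ∃ X : RMSurface n D, SymplecticFrame n X.lattice X.form l₁ l₂ m₁ m₂ ∧
      ActsBy n X.gamma t l₁ l₂ m₁ m₂ := by
  have hE := T.alternating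
  let u : T.endRing := ⟨f, fun v hv => hA.map_mem hF hv⟩
  have hu : u * u = ((D - D ^ 2) / 4) • 1 + D • u := by
    apply Subtype.ext
    show f * f = ((D - D ^ 2) / 4) • (1 : Module.End ℂ C2) + D • f
    rw [hF.sq_eq T.span_eq_top hA, ht.tr, ht.nm]
    module
  obtain ⟨ρ, hρ⟩ := exists_ringHom_quadOrder u hu
  have hρf : (ρ (gammaD D) : Module.End ℂ C2) = f := by rw [hρ]
  have hρa : ∀ (a : QuadOrder D) (v : C2), (ρ a : Module.End ℂ C2) v = a.re • v + a.im • f v := by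
    intro a v
    rw [ringHom_quadOrder_apply ρ a, hρ]
    show ((a.re : Module.End ℂ C2) + (a.im : Module.End ℂ C2) * f) v = _
    rw [← zsmul_eq_mul, ← zsmul_one]
    rfl
  have hself : ∀ v w, T.form (f v) w = T.form v (f w) := by
    have : T.form.compl₁₂ (f.restrictScalars ℝ) LinearMap.id =
        T.form.compl₁₂ LinearMap.id (f.restrictScalars ℝ) := by
      refine hF.ext_real T.span_eq_top ?_ ?_ ?_ ?_ <;>
      refine hF.ext_real T.span_eq_top ?_ ?_ ?_ ?_ <;>
      simp only [LinearMap.compl₁₂_apply, LinearMap.id_apply, LinearMap.restrictScalars_apply,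
        hA.map_l₁, hA.map_l₂, hA.map_m₁, hA.map_m₂, map_add, LinearMap.add_apply, form_zsmul_left,
        form_zsmul_right, hE, hF.l₁_l₂, hF.m₁_m₂, hF.l₁_m₁, hF.l₂_m₂, hF.l₁_m₂, hF.l₂_m₁,
        form_swap hE l₁ l₂, form_swap hE m₁ m₂, form_swap hE l₁ m₁, form_swap hE l₂ m₂,
        form_swap hE l₁ m₂, form_swap hE l₂ m₁] <;> push_cast <;> ring
    exact fun v w => LinearMap.congr_fun (LinearMap.congr_fun this v) w
  refine ⟨{ T with ρ := ρ, injective := ?_, selfAdjoint := ?_, proper := ?_ }, hF, ?_⟩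
  · rw [injective_iff_map_eq_zero]
    intro a ha
    have h0 : ∀ v, a.re • v + a.im • f v = 0 := fun v => by rw [← hρa, ha]; rfl
    have k1 := hF.int_ext hE hn (x := a.re + a.im * t.α) (y := a.im * t.c) (z := 0)
      (w := a.im * t.d) (x' := 0) (y' := 0) (z' := 0) (w' := 0)
      (by have := h0 l₁; rw [hA.map_l₁] at this
          rw [← sub_eq_zero, ← this]; module)
    have k2 := hF.int_ext hE hn (x := a.im * (n * t.β)) (y := a.re + a.im * t.δ)
      (z := a.im * (-(n * t.d))) (w := 0) (x' := 0) (y' := 0) (z' := 0) (w' := 0)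
      (by have := h0 l₂; rw [hA.map_l₂] at this
          rw [← sub_eq_zero, ← this]; module)
    have k3 := hF.int_ext hE hn (x := 0) (y := a.im * t.e) (z := a.re + a.im * t.α)
      (w := a.im * t.β) (x' := 0) (y' := 0) (z' := 0) (w' := 0)
      (by have := h0 m₁; rw [hA.map_m₁] at this
          rw [← sub_eq_zero, ← this]; module)
    have him : a.im = 0 := by
      by_contra h
      have hb : a.im * (t.α - t.δ) = 0 := by linarith [k1.1, k2.2.1]
      have h0 : ∀ x, a.im * x = 0 → (0 : ℤ) ∣ x := fun x hx =>
        zero_dvd_iff.2 ((mul_eq_zero.1 hx).resolve_left h)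
      exact not_isUnit_zero (ht.primitive 0 (h0 _ k3.2.2.2) (h0 _ k1.2.1) (h0 _ k1.2.2.2)
        (h0 _ k3.2.1) (h0 _ hb))
    have hre : a.re = 0 := by
      have := k1.1
      rwa [him, zero_mul, add_zero] at this
    exact QuadraticAlgebra.ext hre him
  · intro a v w
    show T.form ((ρ a : Module.End ℂ C2) v) w = T.form v ((ρ a : Module.End ℂ C2) w)
    rw [hρa, hρa]
    simp only [map_add, LinearMap.add_apply, form_zsmul_left, form_zsmul_right, hself]
  · exact ht.primitive.isProperAction hn hF (by rwa [hρf])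
  · show ActsBy n (ρ (gammaD D) : Module.End ℂ C2) t l₁ l₂ m₁ m₂
    rwa [hρf]

/-- The points of `ℍ₂` that satisfy the relation given by admissible data are periods. -/
theorem RMData.IsAdmissible.exists_isPeriod (hn : 0 < n) {t : RMData} (ht : t.IsAdmissible n D)
    {z : Fin 3 → ℂ} (hz : z ∈ siegelSpace) (hrel : t.relation n z = 0) :
    ∃ X : RMSurface n D, IsPeriod X z (t.mat n) := by
  obtain ⟨T, hF⟩ := exists_surface hn hz
  -- The columns are forced by the required values at `m₁` and `m₂ / n`, a `ℂ`-basis. The conditions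
  -- at `l₁` and `l₂` then reduce to the relation.
  let f : Module.End ℂ C2 := Matrix.toLin' !![t.e * z 1 + t.α, t.c - t.e * z 0;
    t.e * z 2 + n * t.β, t.δ - t.e * z 1]
  have hf : ActsBy n f t ![z 0, z 1] ![z 1, z 2] ![1, 0] ![0, (n : ℂ)] := by
    unfold RMData.relation at hrel
    constructor
    · ext i
      fin_cases i
      · simp [f, Matrix.toLin'_apply, Matrix.mulVec, dotProduct, Fin.sum_univ_two]; ring
      · simp [f, Matrix.toLin'_apply, Matrix.mulVec, dotProduct, Fin.sum_univ_two]
        linear_combination hrel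
    · ext i
      fin_cases i
      · simp [f, Matrix.toLin'_apply, Matrix.mulVec, dotProduct, Fin.sum_univ_two]
        linear_combination -hrel
      · simp [f, Matrix.toLin'_apply, Matrix.mulVec, dotProduct, Fin.sum_univ_two]; ring
    · ext i
      fin_cases i
      · simp [f, Matrix.toLin'_apply, Matrix.mulVec, dotProduct, Fin.sum_univ_two]
      · simp [f, Matrix.toLin'_apply, Matrix.mulVec, dotProduct, Fin.sum_univ_two]; ring
    · ext i
      fin_cases i
      · simp [f, Matrix.toLin'_apply, Matrix.mulVec, dotProduct, Fin.sum_univ_two]; ring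
      · simp [f, Matrix.toLin'_apply, Matrix.mulVec, dotProduct, Fin.sum_univ_two]; ring
  obtain ⟨X, hF', hA⟩ := hF.exists_rmSurface hn ht hf
  exact ⟨X, (isPeriod_mat_iff hn).2 ⟨_, _, _, _, LinearEquiv.refl ℂ C2, hF', hA, rfl, rfl, rfl,
    rfl⟩⟩

theorem RMSurface.HasData.exists_isPeriod (hn : 0 < n) {X : RMSurface n D} {t : RMData}
    (h : X.HasData t) : ∃ z ∈ siegelSpace, IsPeriod X z (t.mat n) := by
  obtain ⟨l₁, l₂, m₁, m₂, hF, hA⟩ := h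
  obtain ⟨z, hz, φ, hφ⟩ := hF.exists_hasPeriods hn X.toPolarizedAbelianSurface
  exact ⟨z, hz, (isPeriod_mat_iff hn).2 ⟨_, _, _, _, φ, hF, hA, hφ⟩⟩

theorem IsPeriod.relation_eq_zero (hn : 0 < n) {X : RMSurface n D} {z : Fin 3 → ℂ} {t : RMData}
    (h : IsPeriod X z (t.mat n)) : t.relation n z = 0 := by
  obtain ⟨l₁, l₂, m₁, m₂, φ, -, hA, hφ⟩ := (isPeriod_mat_iff hn).1 h
  exact hφ.relation_eq_zero hn hA

/-! ### Analytic subsets and the identity theorem -/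

section Analytic

variable {V V' : Type*} [NormedAddCommGroup V] [NormedSpace ℂ V] [NormedAddCommGroup V']
  [NormedSpace ℂ V']

theorem IsAnalyticSubset.preimage {U A : Set V'} (h : IsAnalyticSubset U A) {g : V → V'}
    {Ω : Set V} (hΩ : IsOpen Ω) (hg : AnalyticOnNhd ℂ g Set.univ) (hm : Set.MapsTo g Ω U) :
    IsAnalyticSubset Ω (Ω ∩ g ⁻¹' A) := by
  refine ⟨Set.inter_subset_left, fun p hp => ?_⟩
  obtain ⟨W, hW, hpW, -, k, f, hf, hA⟩ := h.2 (g p) (hm hp)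
  refine ⟨Ω ∩ g ⁻¹' W, hΩ.inter (hW.preimage ?_), ⟨hp, hpW⟩, Set.inter_subset_left, k,
    fun j => f j ∘ g, fun j x hx => (hf j (g x) hx.2).comp (hg x trivial), ?_⟩
  · exact continuousOn_univ.1 hg.continuousOn
  · ext x
    have := Set.ext_iff.1 hA (g x)
    simp only [Set.mem_inter_iff, Set.mem_ofPred_eq, Set.mem_preimage, Function.comp_apply] at this ⊢
    tauto

theorem IsAnalyticSubset.isOpen_diff {Ω A : Set V} (h : IsAnalyticSubset Ω A) :
    IsOpen (Ω \ A) := by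
  rw [isOpen_iff_mem_nhds]
  rintro p ⟨hp, hpA⟩
  obtain ⟨W, hW, hpW, hWΩ, k, f, hf, hA⟩ := h.2 p hp
  obtain ⟨j, hj⟩ : ∃ j, f j p ≠ 0 := by
    by_contra! H
    exact hpA (hA.symm.subset ⟨hpW, H⟩).1
  filter_upwards [hW.mem_nhds hpW, (hf j p hpW).continuousAt.eventually_ne hj] with w hw hwj
  exact ⟨hWΩ hw, fun hwA => hwj ((hA.subset ⟨hwA, hw⟩).2 j)⟩

/-- By the identity theorem on small balls, the interior of `A` contains every point of `Ω` in its
closure, so connectedness applies. -/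
theorem IsAnalyticSubset.subset_of_interior_nonempty {Ω A : Set V} (h : IsAnalyticSubset Ω A)
    (hΩ : IsPreconnected Ω) (hA : (interior A).Nonempty) : Ω ⊆ A := by
  refine Set.Subset.trans (hΩ.subset_of_closure_inter_subset isOpen_interior ?_ ?_) interior_subset
  · obtain ⟨x, hx⟩ := hA
    exact ⟨x, h.1 (interior_subset hx), hx⟩
  · rintro p ⟨hp, hpΩ⟩
    obtain ⟨W, hW, hpW, -, k, f, hf, hAW⟩ := h.2 p hpΩ
    obtain ⟨r, hr, hball⟩ := Metric.isOpen_iff.1 hW p hpW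
    obtain ⟨q, hq, hqA⟩ := mem_closure_iff.1 hp _ Metric.isOpen_ball (Metric.mem_ball_self hr)
    have hz : ∀ j, Set.EqOn (f j) 0 (Metric.ball p r) := fun j => by
      refine ((hf j).mono hball).eqOn_zero_of_preconnected_of_eventuallyEq_zero
        (convex_ball (E := V) p r).isPreconnected hq ?_
      filter_upwards [isOpen_interior.mem_nhds hqA, Metric.isOpen_ball.mem_nhds hq] with w hw hwb
      exact (hAW.subset ⟨interior_subset hw, hball hwb⟩).2 j
    refine mem_interior.2 ⟨_, fun w hw => ?_, Metric.isOpen_ball, Metric.mem_ball_self hr⟩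
    exact (hAW.symm.subset ⟨hball hw, fun j => hz j hw⟩).1

/-- A connected open set that is covered by finitely many analytic subsets is one of them. -/
theorem exists_subset_of_isAnalyticSubset {Ω : Set V} (hΩ : IsPreconnected Ω)
    {F : Set (Set V)} (hF : F.Finite) (hA : ∀ S ∈ F, IsAnalyticSubset Ω S) {U : Set V}
    (hU : IsOpen U) (hUne : U.Nonempty) (hUΩ : U ⊆ Ω) (hcov : U ⊆ ⋃₀ F) : ∃ S ∈ F, Ω ⊆ S := by
  induction F, hF using Set.Finite.induction_on generalizing U with
  | empty => obtain ⟨x, hx⟩ := hUne; simpa using hcov hx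
  | @insert S F _ _ ih =>
    have hS := hA S (Set.mem_insert _ _)
    by_cases hi : (interior S).Nonempty
    · exact ⟨S, Set.mem_insert _ _, hS.subset_of_interior_nonempty hΩ hi⟩
    -- A set without interior can be removed from `U`, leaving a non-empty open set covered by the
    -- remaining ones.
    · have hne : (U ∩ (Ω \ S)).Nonempty := by
        by_contra hE
        refine hi (hUne.mono (interior_maximal (fun x hx => ?_) hU))
        by_contra hxS
        exact hE ⟨x, hx, hUΩ hx, hxS⟩
      obtain ⟨T, hT, hΩT⟩ := ih (fun T hT => hA T (Set.mem_insert_of_mem _ hT))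
        (hU.inter hS.isOpen_diff) hne (fun x hx => hUΩ hx.1) (fun x hx => by
          obtain ⟨T, hT, hxT⟩ := hcov hx.1
          rcases hT with rfl | hT
          · exact absurd hxT hx.2.2
          · exact ⟨T, hT, hxT⟩)
      exact ⟨T, Set.mem_insert_of_mem _ hT, hΩT⟩

end Analytic

theorem isOpen_siegelSpace : IsOpen siegelSpace := by
  have : siegelSpace = {z | 0 < (z 0).im ∧ (z 1).im ^ 2 < (z 0).im * (z 2).im} :=
    Set.ext fun z => mem_siegelSpace_iff
  rw [this]
  have h (i : Fin 3) : Continuous fun z : Fin 3 → ℂ => (z i).im := by fun_prop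
  exact (isOpen_lt continuous_const (h 0)).inter (isOpen_lt ((h 1).pow 2) ((h 0).mul (h 2)))

theorem convex_siegelSpace : Convex ℝ siegelSpace := by
  rw [convex_iff_forall_pos]
  intro z hz w hw a b ha hb _
  have : (symMatrix (a • z + b • w)).map Complex.im =
      a • (symMatrix z).map Complex.im + b • (symMatrix w).map Complex.im := by
    ext i j
    fin_cases i <;> fin_cases j <;> simp [symMatrix]
  show ((symMatrix (a • z + b • w)).map Complex.im).PosDef
  rw [this]
  exact (Matrix.PosDef.smul hz ha).add (Matrix.PosDef.smul hw hb)

theorem isAnalyticSubset_relation (t : RMData) :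
    IsAnalyticSubset siegelSpace {z | z ∈ siegelSpace ∧ t.relation n z = 0} := by
  refine ⟨fun z hz => hz.1, fun p hp => ⟨siegelSpace, isOpen_siegelSpace, hp, subset_rfl, 1,
    fun _ => t.relation n, fun _ z _ => ?_, ?_⟩⟩
  · have : ContDiff ℂ ω (t.relation n) := by
      unfold RMData.relation
      fun_prop
    exact contDiff_omega_iff_analyticOnNhd.1 this _ trivial
  · ext z
    exact ⟨fun h => ⟨h.2, fun _ => h.1.2⟩, fun h => ⟨⟨h.1, h.2 0⟩, h.1⟩⟩

theorem isAnalyticSubset_empty : IsAnalyticSubset siegelSpace ∅ :=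
  ⟨Set.empty_subset _, fun p hp => ⟨siegelSpace, isOpen_siegelSpace, hp, subset_rfl, 1,
    fun _ _ => 1, fun _ _ _ => analyticAt_const, by ext z; simp⟩⟩

/-! ### Irreducibility of the residue classes -/

/-- The classes of surfaces on which `γ` acts as the scalar `a` modulo `n`. -/
def ModuliSpace.residueClass (n : ℕ) (D a : ℤ) : Set (ModuliSpace n D) :=
  {x | ∃ X, ModuliSpace.mk X = x ∧ X.HasResidue a}

theorem ModuliSpace.mk_eq_iff {X Y : RMSurface n D} :
    ModuliSpace.mk X = ModuliSpace.mk Y ↔ X.Iso Y :=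
  Quotient.eq (r := RMSurface.isoSetoid n D)

theorem ModuliSpace.mk_mem_residueClass {X : RMSurface n D} {a : ℤ} :
    ModuliSpace.mk X ∈ residueClass n D a ↔ X.HasResidue a := by
  constructor
  · rintro ⟨Y, hY, h⟩
    exact (mk_eq_iff.1 hY).hasResidue h
  · exact fun h => ⟨X, rfl, h⟩

theorem IsPeriod.hasData (hn : 0 < n) {X : RMSurface n D} {z : Fin 3 → ℂ} {t : RMData}
    (h : IsPeriod X z (t.mat n)) : X.HasData t := by
  obtain ⟨l₁, l₂, m₁, m₂, φ, hF, hA, -⟩ := (isPeriod_mat_iff hn).1 h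
  exact ⟨_, _, _, _, hF, hA⟩

/-- The matrix `R` already fixes `α`, so for each `R` the locus is either empty or the full zero set
of one relation in `ℍ₂`. -/
theorem ModuliSpace.isAnalytic_residueClass (hn : 0 < n)
    (hdisc : D ≡ 0 [ZMOD 4] ∨ D ≡ 1 [ZMOD 4]) (a : ℤ) : IsAnalytic (residueClass n D a) := by
  intro R
  rcases Set.eq_empty_or_nonempty
    {z | z ∈ siegelSpace ∧ ∃ X : RMSurface n D, mk X ∈ residueClass n D a ∧ IsPeriod X z R}
    with h | ⟨z₀, hz₀, X, hX, hP⟩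
  · rw [h]; exact isAnalyticSubset_empty
  · obtain ⟨t, rfl, ht⟩ := hP.exists_data hn
    convert! isAnalyticSubset_relation (n := n) t using 1
    ext z
    refine and_congr_right fun hz => ⟨fun ⟨Y, _, hY⟩ => hY.relation_eq_zero hn, fun hrel => ?_⟩
    obtain ⟨Y, hY⟩ := (ht.isAdmissible hdisc).exists_isPeriod hn hz hrel
    refine ⟨Y, mk_mem_residueClass.2 (((hY.hasData hn).hasResidue_iff a).2 ?_), hY⟩
    exact (ht.hasResidue_iff a).1 (mk_mem_residueClass.1 hX)

theorem ModuliSpace.isClosed_of_isAnalytic {S : Set (ModuliSpace n D)} (h : IsAnalytic S) :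
    IsClosed S := by
  rw [← isOpen_compl_iff]
  refine TopologicalSpace.GenerateOpen.basic _ ?_
  show IsAnalytic Sᶜᶜ
  rwa [compl_compl]

/-- The complements of analytic sets are only a subbasis. Finite intersections of them form a basis,
which is why finite covers by analytic sets have to be considered. -/
theorem ModuliSpace.isIrreducible_of_cover {S : Set (ModuliSpace n D)} (hne : S.Nonempty)
    (hS : ∀ F : Set (Set (ModuliSpace n D)), F.Finite → (∀ T ∈ F, IsAnalytic T) → S ⊆ ⋃₀ F →
      ∃ T ∈ F, S ⊆ T) : IsIrreducible S := by
  refine ⟨hne, ?_⟩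
  rintro u v hu hv ⟨x, hxS, hxu⟩ ⟨y, hyS, hyv⟩
  have hB := TopologicalSpace.isTopologicalBasis_of_subbasis
    (t := (inferInstance : TopologicalSpace (ModuliSpace n D))) rfl
  obtain ⟨-, ⟨f, ⟨hf, hfs⟩, rfl⟩, hxf, hfu⟩ := hB.exists_subset_of_mem_open hxu hu
  obtain ⟨-, ⟨g, ⟨hg, hgs⟩, rfl⟩, hyg, hgv⟩ := hB.exists_subset_of_mem_open hyv hv
  by_contra hE
  obtain ⟨T, hT, hST⟩ := hS (compl '' (f ∪ g)) ((hf.union hg).image _)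
    (by rintro _ ⟨U, hU | hU, rfl⟩
        · exact hfs hU
        · exact hgs hU)
    (fun w hw => by
      by_contra hwc
      have hU : ∀ U ∈ f ∪ g, w ∈ U := fun U hU => by
        by_contra hwU
        exact hwc ⟨Uᶜ, ⟨U, hU, rfl⟩, hwU⟩
      exact hE ⟨w, hw, hfu fun U h => hU U (Or.inl h), hgv fun U h => hU U (Or.inr h)⟩)
  obtain ⟨U, hU | hU, rfl⟩ := hT
  · exact hST hxS (hxf U hU)
  · exact hST hyS (hyg U hU)

/-- The data with `c = 1` and `d = e = 0`. -/
def normalData (D a β : ℤ) : RMData := ⟨a, β, 1, 0, 0, D - a⟩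

theorem normalData_isAdmissible {a β : ℤ} (h : a * (D - a) + (D - D ^ 2) / 4 = n * β) :
    (normalData D a β).IsAdmissible n D where
  tr := by simp [normalData, RMData.tr]
  nm := by simp only [normalData, RMData.nm]; linarith
  primitive m _ hc _ _ _ := isUnit_of_dvd_one hc

/-- The affine plane of solutions of the relation given by normal data. -/
def normalPlane (n : ℕ) (D a β : ℤ) (w : ℂ × ℂ) : Fin 3 → ℂ :=
  ![w.1, w.2, n * β * w.1 + (D - 2 * a) * w.2]

/-- With `e = 0` the quadratic term of the relation disappears, and `c = 1` lets it be solved for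
the last coordinate. -/
theorem normalData_relation_eq_zero_iff {a β : ℤ} {z : Fin 3 → ℂ} :
    (normalData D a β).relation n z = 0 ↔ z = normalPlane n D a β (z 0, z 1) := by
  constructor
  · intro h
    simp [RMData.relation, normalData] at h
    ext i
    fin_cases i
    · rfl
    · rfl
    · simp only [normalPlane]
      show z 2 = n * β * z 0 + (D - 2 * a) * z 1
      linear_combination -h
  · intro h
    have h2 : z 2 = n * β * z 0 + (D - 2 * a) * z 1 := congrFun h 2
    simp [RMData.relation, normalData]
    linear_combination -h2

theorem continuous_normalPlane (a β : ℤ) : Continuous (normalPlane n D a β) := by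
  unfold normalPlane
  refine continuous_pi fun i => ?_
  fin_cases i
  · exact continuous_fst
  · exact continuous_snd
  · show Continuous fun w : ℂ × ℂ => (n * β * w.1 + (D - 2 * a) * w.2 : ℂ)
    fun_prop

theorem analyticOnNhd_normalPlane (a β : ℤ) :
    AnalyticOnNhd ℂ (normalPlane n D a β) Set.univ := by
  intro w _
  rw [analyticAt_pi_iff]
  intro i
  fin_cases i
  · exact analyticAt_fst
  · exact analyticAt_snd
  · have : ContDiff ℂ ω (fun w : ℂ × ℂ => (n * β * w.1 + (D - 2 * a) * w.2 : ℂ)) := by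
      fun_prop
    exact contDiff_omega_iff_analyticOnNhd.1 this _ trivial

theorem convex_preimage_normalPlane (a β : ℤ) :
    Convex ℝ (normalPlane n D a β ⁻¹' siegelSpace) := by
  refine convex_siegelSpace.is_linear_preimage ⟨fun x y => ?_, fun c x => ?_⟩
  · ext i
    fin_cases i <;> simp [normalPlane]
    ring
  · ext i
    fin_cases i <;> simp [normalPlane]
    ring

theorem preimage_normalPlane_nonempty (hD : 0 < D)
    (hdisc : D ≡ 0 [ZMOD 4] ∨ D ≡ 1 [ZMOD 4]) {a β : ℤ}
    (h : a * (D - a) + (D - D ^ 2) / 4 = n * β) :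
    (normalPlane n D a β ⁻¹' siegelSpace).Nonempty := by
  -- At this point the determinant of the imaginary part is `(D - 2a)² + 4nβ = D`, which is
  -- positive.
  refine ⟨(2 * Complex.I, (D - 2 * a : ℤ) * Complex.I), ?_⟩
  rw [Set.mem_preimage, mem_siegelSpace_iff]
  have h4 := four_dvd_sub_sq hdisc
  have hβ : (D - 2 * a) ^ 2 + 4 * (n * β) = D := by
    linear_combination -4 * h + h4
  have hβ' : ((D : ℝ) - 2 * a) ^ 2 + 4 * (n * β) = D := by exact_mod_cast hβ
  have hD' : (0 : ℝ) < D := by exact_mod_cast hD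
  constructor
  · simp [normalPlane]
  · simp [normalPlane]
    nlinarith

/-- In normal form the trace determines `δ` and the norm determines `β`, so the residue alone fixes
the data. -/
theorem RMSurface.HasResidue.hasData_normalData (hn : 0 < n) (hdisc : D ≡ 0 [ZMOD 4] ∨ D ≡ 1 [ZMOD 4])
    (hsq : ¬ IsSquare D) {a β : ℤ} (h : a * (D - a) + (D - D ^ 2) / 4 = n * β)
    {X : RMSurface n D} (hX : X.HasResidue a) : X.HasData (normalData D a β) := by
  obtain ⟨⟨α', β', c', d', e', δ'⟩, ht, h1, h2, h3, h4⟩ := hX.exists_normal hn hdisc hsq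
  obtain ⟨htr, hnm⟩ := ht.tr_nm
  simp only [RMData.tr, RMData.nm] at h1 h2 h3 h4 htr hnm
  subst h1 h2 h3 h4
  obtain rfl : δ' = D - α' := by linarith
  have hn' : (n : ℤ) ≠ 0 := by exact_mod_cast hn.ne'
  obtain rfl : β' = β := mul_left_cancel₀ hn' (by linarith)
  exact ht

/-- All surfaces of the class have a period in one convex plane section `Ω` of `ℍ₂`. A finite
analytic cover of the class pulls back to `Ω`, where one member must be everything; as periods
determine surfaces, that member contains the class. -/
theorem ModuliSpace.isIrreducible_residueClass (hn : 0 < n) (hD : 0 < D)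
    (hdisc : D ≡ 0 [ZMOD 4] ∨ D ≡ 1 [ZMOD 4]) (hsq : ¬ IsSquare D) {a : ℤ}
    (h : (n : ℤ) ∣ a * (D - a) + (D - D ^ 2) / 4) : IsIrreducible (residueClass n D a) := by
  obtain ⟨β, hβ⟩ := h
  have hadm := normalData_isAdmissible hβ
  set Ω := normalPlane n D a β ⁻¹' siegelSpace with hΩ
  have hΩo : IsOpen Ω := isOpen_siegelSpace.preimage (continuous_normalPlane a β)
  have hΩne : Ω.Nonempty := preimage_normalPlane_nonempty hD hdisc hβ
  have hΩc : IsPreconnected Ω := (convex_preimage_normalPlane a β).isPreconnected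
  have hper : ∀ w ∈ Ω, ∃ X : RMSurface n D, mk X ∈ residueClass n D a ∧
      IsPeriod X (normalPlane n D a β w) ((normalData D a β).mat n) := by
    intro w hw
    obtain ⟨X, hX⟩ := hadm.exists_isPeriod hn hw (normalData_relation_eq_zero_iff.2 rfl)
    exact ⟨X, mk_mem_residueClass.2 (((hX.hasData hn).hasResidue_iff a).2 (by simp [normalData])),
      hX⟩
  refine isIrreducible_of_cover ?_ fun F hF hFa hcov => ?_
  · obtain ⟨w, hw⟩ := hΩne
    obtain ⟨X, hX, -⟩ := hper w hw
    exact ⟨_, hX⟩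
  · let A : Set (ModuliSpace n D) → Set (Fin 3 → ℂ) := fun T =>
      {z | z ∈ siegelSpace ∧ ∃ X : RMSurface n D, mk X ∈ T ∧
        IsPeriod X z ((normalData D a β).mat n)}
    obtain ⟨_, ⟨T, hT, rfl⟩, hΩT⟩ := exists_subset_of_isAnalyticSubset hΩc
      (F := (fun T => Ω ∩ normalPlane n D a β ⁻¹' A T) '' F) (hF.image _)
      (by rintro _ ⟨T, hT, rfl⟩
          exact (hFa T hT _).preimage hΩo (analyticOnNhd_normalPlane a β) fun w hw => hw)
      hΩo hΩne subset_rfl (fun w hw => by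
        obtain ⟨X, hX, hP⟩ := hper w hw
        obtain ⟨T, hT, hXT⟩ := hcov hX
        exact ⟨_, ⟨T, hT, rfl⟩, hw, hw, X, hXT, hP⟩)
    refine ⟨T, hT, ?_⟩
    rintro _ ⟨X, rfl, hX⟩
    obtain ⟨z, hz, hP⟩ :=
      (hX.hasData_normalData hn hdisc hsq hβ).exists_isPeriod hn
    have hzw := normalData_relation_eq_zero_iff.1 (hP.relation_eq_zero hn)
    have hw : (z 0, z 1) ∈ Ω := by
      rw [hΩ, Set.mem_preimage, ← hzw]; exact hz
    obtain ⟨-, -, Y, hY, hPY⟩ := hΩT hw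
    rw [← hzw] at hPY
    rwa [mk_eq_iff.2 (hP.iso hn hPY)]

/-- Modulo `n` the norm is `αδ = α(D - α)`, which yields the congruence for the remainder of `α`. -/
theorem RMSurface.exists_hasResidue (hn : 0 < n) (X : RMSurface n D) :
    ∃ a : ℤ, 0 ≤ a ∧ a < n ∧ X.HasResidue a ∧ (n : ℤ) ∣ a * (D - a) + (D - D ^ 2) / 4 := by
  obtain ⟨t, ht⟩ := X.exists_hasData hn
  have hn' : (0 : ℤ) < n := by exact_mod_cast hn
  refine ⟨t.α % n, Int.emod_nonneg _ hn'.ne', Int.emod_lt_of_pos _ hn',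
    (ht.hasResidue_iff _).2 (Int.dvd_self_sub_emod), ?_⟩
  obtain ⟨htr, hnm⟩ := ht.tr_nm
  have h1 : t.α = t.α % n + n * (t.α / n) := (Int.emod_add_mul_ediv _ _).symm
  have hδ : t.δ = D - t.α := by rw [← htr]; unfold RMData.tr; ring
  unfold RMData.nm at hnm
  rw [hδ] at hnm
  generalize t.α % n = r at h1 ⊢
  generalize t.α / n = q at h1
  rw [h1] at hnm
  exact ⟨t.β * t.c - t.d * t.e - q * (D - 2 * r) + n * q ^ 2, by linear_combination hnm⟩

theorem RMSurface.HasResidue.dvd_sub (hn : 0 < n) {X : RMSurface n D} {a b : ℤ}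
    (ha : X.HasResidue a) (hb : X.HasResidue b) : (n : ℤ) ∣ a - b := by
  obtain ⟨t, ht⟩ := X.exists_hasData hn
  have h1 := (ht.hasResidue_iff a).1 ha
  have h2 := (ht.hasResidue_iff b).1 hb
  have := _root_.dvd_sub h2 h1
  rwa [show t.α - b - (t.α - a) = a - b by ring] at this

/-! ### Components of the moduli space and the count for `n = 6` -/

/-- The residues modulo `n` by which `γ` can act. -/
def residues (n : ℕ) (D : ℤ) : Finset ℤ :=
  (Finset.Ico 0 (n : ℤ)).filter fun a => (n : ℤ) ∣ a * (D - a) + (D - D ^ 2) / 4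

theorem mem_residues {a : ℤ} : a ∈ residues n D ↔
    (0 ≤ a ∧ a < n) ∧ (n : ℤ) ∣ a * (D - a) + (D - D ^ 2) / 4 := by
  rw [residues, Finset.mem_filter, Finset.mem_Ico]

theorem ModuliSpace.exists_mem_residueClass (hn : 0 < n) (x : ModuliSpace n D) :
    ∃ a ∈ residues n D, x ∈ residueClass n D a := by
  obtain ⟨X, rfl⟩ := Quotient.exists_rep x
  obtain ⟨a, h0, h1, h2, h3⟩ := X.exists_hasResidue hn
  exact ⟨a, mem_residues.2 ⟨⟨h0, h1⟩, h3⟩, X, rfl, h2⟩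

theorem ModuliSpace.eq_of_mem_residueClass (hn : 0 < n) {a b : ℤ} (ha : a ∈ residues n D)
    (hb : b ∈ residues n D) {x : ModuliSpace n D} (hxa : x ∈ residueClass n D a)
    (hxb : x ∈ residueClass n D b) : a = b := by
  obtain ⟨X, rfl, hX⟩ := hxa
  have h := hX.dvd_sub hn (mk_mem_residueClass.1 hxb)
  rw [mem_residues] at ha hb
  have : a - b = 0 := Int.eq_zero_of_abs_lt_dvd h (by rw [abs_lt]; constructor <;> linarith)
  linarith

/-- The irreducible components of the moduli space are the classes given by the residues. -/
theorem ModuliSpace.irreducibleComponents_eq (hn : 0 < n) (hD : 0 < D)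
    (hdisc : D ≡ 0 [ZMOD 4] ∨ D ≡ 1 [ZMOD 4]) (hsq : ¬ IsSquare D) :
    irreducibleComponents (ModuliSpace n D) = residueClass n D '' residues n D := by
  have hirr : ∀ a ∈ residues n D, IsIrreducible (residueClass n D a) := fun a ha =>
    isIrreducible_residueClass hn hD hdisc hsq (mem_residues.1 ha).2
  -- The classes are finitely many closed sets that cover the space, so an irreducible set lies in
  -- one of them.
  have hsub : ∀ S : Set (ModuliSpace n D), IsIrreducible S →
      ∃ a ∈ residues n D, S ⊆ residueClass n D a := by
    classical
    intro S hS
    obtain ⟨T, hT, hST⟩ := isIrreducible_iff_sUnion_isClosed.1 hS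
      ((residues n D).image (residueClass n D)) (fun T hT => by
        obtain ⟨a, -, rfl⟩ := Finset.mem_image.1 hT
        exact isClosed_of_isAnalytic (isAnalytic_residueClass hn hdisc a))
      (fun x _ => by
        obtain ⟨a, ha, hx⟩ := exists_mem_residueClass hn x
        exact ⟨_, Finset.mem_coe.2 (Finset.mem_image_of_mem _ ha), hx⟩)
    obtain ⟨a, ha, rfl⟩ := Finset.mem_image.1 hT
    exact ⟨a, ha, hST⟩
  ext S
  constructor
  · intro hS
    obtain ⟨a, ha, hSa⟩ := hsub S hS.1
    exact ⟨a, ha, Set.Subset.antisymm (hS.2 (hirr a ha) hSa) hSa⟩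
  · rintro ⟨a, ha, rfl⟩
    refine ⟨hirr a ha, fun S hS haS => ?_⟩
    obtain ⟨b, hb, hSb⟩ := hsub S hS
    obtain ⟨x, hx⟩ := (hirr a ha).nonempty
    obtain rfl := eq_of_mem_residueClass hn ha hb hx (hSb (haS hx))
    exact hSb

theorem ModuliSpace.encard_irreducibleComponents (hn : 0 < n) (hD : 0 < D)
    (hdisc : D ≡ 0 [ZMOD 4] ∨ D ≡ 1 [ZMOD 4]) (hsq : ¬ IsSquare D) :
    (irreducibleComponents (ModuliSpace n D)).encard = (residues n D).card := by
  rw [irreducibleComponents_eq hn hD hdisc hsq, Set.InjOn.encard_image, Set.encard_coe_eq_coe_finsetCard]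
  intro a ha b hb hab
  obtain ⟨x, hx⟩ :=
    (isIrreducible_residueClass hn hD hdisc hsq (mem_residues.1 ha).2).nonempty
  exact eq_of_mem_residueClass hn ha hb hx (hab ▸ hx)

theorem ModuliSpace.irreducibleSpace_of_residues (hn : 0 < n) (hD : 0 < D)
    (hdisc : D ≡ 0 [ZMOD 4] ∨ D ≡ 1 [ZMOD 4]) (hsq : ¬ IsSquare D) {a : ℤ}
    (h : residues n D = {a}) : IrreducibleSpace (ModuliSpace n D) := by
  have ha : a ∈ residues n D := by rw [h]; exact Finset.mem_singleton_self a
  have hu : residueClass n D a = Set.univ := by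
    refine Set.eq_univ_of_forall fun x => ?_
    obtain ⟨b, hb, hx⟩ := exists_mem_residueClass hn x
    rw [h, Finset.mem_singleton] at hb
    exact hb ▸ hx
  rw [irreducibleSpace_def, Set.top_eq_univ, ← hu]
  exact isIrreducible_residueClass hn hD hdisc hsq (mem_residues.1 ha).2

theorem ModuliSpace.isEmpty_of_residues (hn : 0 < n) (h : residues n D = ∅) :
    IsEmpty (ModuliSpace n D) := by
  refine ⟨fun x => ?_⟩
  obtain ⟨a, ha, -⟩ := exists_mem_residueClass hn x
  simp [h] at ha

/-- Multiplying by 4 removes the division and turns the condition into `(2a - D)² ≡ D` modulo 24,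
which depends only on `D` modulo 24 and so can be decided case by case. -/
theorem mem_residues_six (hdisc : D ≡ 0 [ZMOD 4] ∨ D ≡ 1 [ZMOD 4]) {a : ℤ} :
    a ∈ residues 6 D ↔ (0 ≤ a ∧ a < 6) ∧ (24 : ℤ) ∣ 4 * a * (D % 24 - a) + (D % 24 - (D % 24) ^ 2) := by
  rw [mem_residues]
  push_cast
  refine and_congr_right fun _ => ?_
  have h4 := four_dvd_sub_sq hdisc
  have hD : D = D % 24 + 24 * (D / 24) := (Int.emod_add_mul_ediv _ _).symm
  generalize D % 24 = r at hD ⊢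
  generalize D / 24 = k at hD
  rw [show (24 : ℤ) = 4 * 6 by norm_num, ← mul_dvd_mul_iff_left (a := (4 : ℤ)) (by norm_num)
    (b := 6), mul_add, h4, hD]
  have e : 4 * (a * (r + 24 * k - a)) + (r + 24 * k - (r + 24 * k) ^ 2) =
      4 * a * (r - a) + (r - r ^ 2) + 4 * 6 * (4 * a * k + k - 2 * r * k - 24 * k ^ 2) := by ring
  rw [e]
  exact dvd_add_left (dvd_mul_right _ _)

end RealMult

end

theorem mainTheorem10 (D : ℤ) (hD : 0 < D) (hdisc : D ≡ 0 [ZMOD 4] ∨ D ≡ 1 [ZMOD 4])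
    (hsq : ¬ IsSquare D) :
    ((D ≡ 5 [ZMOD 8] ∨ D ≡ 2 [ZMOD 3]) → IsEmpty (RealMult.ModuliSpace 6 D)) ∧
    ((D ≡ 0 [ZMOD 24] ∨ D ≡ 12 [ZMOD 24]) → IrreducibleSpace (RealMult.ModuliSpace 6 D)) ∧
    ((D ≡ 4 [ZMOD 24] ∨ D ≡ 9 [ZMOD 24] ∨ D ≡ 16 [ZMOD 24]) →
      (irreducibleComponents (RealMult.ModuliSpace 6 D)).encard = 2) ∧
    (D ≡ 1 [ZMOD 24] → (irreducibleComponents (RealMult.ModuliSpace 6 D)).encard = 4) := by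
  have hn : 0 < 6 := by norm_num
  have hmem := fun a => RealMult.mem_residues_six (a := a) hdisc
  have key : ∀ (r : ℤ) (s : Finset ℤ), D % 24 = r →
      (∀ a ∈ Finset.Ico (0 : ℤ) 6, a ∈ s ↔ (24 : ℤ) ∣ 4 * a * (r - a) + (r - r ^ 2)) →
      s ⊆ Finset.Ico (0 : ℤ) 6 → RealMult.residues 6 D = s := by
    intro r s hr hs hsub
    ext a
    rw [hmem, hr, ← Finset.mem_Ico]
    exact ⟨fun h => (hs a h.1).2 h.2, fun h => ⟨hsub h, (hs a (hsub h)).1 h⟩⟩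
  rw [RealMult.ModuliSpace.encard_irreducibleComponents hn hD hdisc hsq]
  unfold Int.ModEq at *
  refine ⟨fun h => ?_, fun h => ?_, fun h => ?_, fun h => ?_⟩
  -- These are the classes modulo 24 that satisfy the hypothesis and are `0` or `1` modulo 4; for
  -- each of them the set of residues is empty.
  · have hr : D % 24 = 5 ∨ D % 24 = 8 ∨ D % 24 = 13 ∨ D % 24 = 17 ∨ D % 24 = 20 ∨ D % 24 = 21 := by
      omega
    refine RealMult.ModuliSpace.isEmpty_of_residues hn ?_
    rcases hr with hr | hr | hr | hr | hr | hr
    all_goals exact key _ _ hr (by decide) (by decide)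
  · rcases h with h | h
    · exact RealMult.ModuliSpace.irreducibleSpace_of_residues hn hD hdisc hsq
        (key 0 {0} h (by decide) (by decide))
    · exact RealMult.ModuliSpace.irreducibleSpace_of_residues hn hD hdisc hsq
        (key 12 {3} h (by decide) (by decide))
  · rcases h with h | h | h
    · rw [key 4 {1, 3} h (by decide) (by decide)]; rfl
    · rw [key 9 {0, 3} h (by decide) (by decide)]; rfl
    · rw [key 16 {0, 4} h (by decide) (by decide)]; rfl
  · rw [key 1 {0, 1, 3, 4} h (by decide) (by decide)]; rfl
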